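/- Let $v:\mathbb R\to\mathbb R$ be a $1$-periodic function, continuous on $[0,1)$, with $v(0)=0$, $v(1-0)=1$, and suppose that for some $\gamma_-,\gamma_+>0$ $$\gamma_-(y-x)\le v(y)-v(x)\le\gamma_+(y-x)\qquad\text{for all } 0\le x\le y<1.$$ Let $\lambda>0$, let $\alpha$ be irrational, and for $x\in\mathbb R$ consider on $\ell^2(\mathbb Z)$ the operator $$(H_{\alpha,\lambda}(x)\psi)(m)=\psi(m+1)+\psi(m-1)+\lambda v(x+m\alpha)\psi(m),\qquad m\in\mathbb Z .$$ Let $\widetilde H_n(x)$ be its restriction to $\ell^2\{0,\dots,n-1\}$ with periodic boundary conditions, that is, $(\widetilde H_n(x)\psi)(m)=\psi((m+1)\bmod n)+\psi((m-1)\bmod n)+\lambda v(x+m\alpha)\psi(m)$. The density of states measure $N(dE)$ is the locally finite Borel measure on $\mathbb R$ defined by $$\int_{\mathbb R} f(E)\,N(dE)=\lim_{n\to\infty}\frac1n\int_{[0,1)}\operatorname{tr} f(\widetilde H_n(x))\,dx$$ for all continuous compactly supported $f$, and the integrated density of states is $N(E)=N((-\infty,E])$. Let $q_k$ ($q_0=1$)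 be the denominators of the continued fraction convergents of $\alpha$ and $\operatorname{er}(\alpha)=\liminf_{k\to\infty} q_{k-1}/q_{k+1}$. **Theorem 3.1.** The density of states measure exists, is unique, and is a probability measure without atoms, so that $N(E)=N((-\infty,E])=N((-\infty,E))$. The integrated density of states is Lipschitz continuous, and for all $E,E'\in\mathbb R$ $$|N(E')-N(E)|\le\frac{|E'-E|}{\lambda\,(1-\operatorname{er}(\alpha))\,\gamma_-}.$$ The density of states measure is absolutely continuous with respect to Lebesgue measure, and for every $x\in\mathbb R$ the spectrum of $H_{\alpha,\lambda}(x)$ has positive Lebesgue measure. -/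

import Mathlib

open MeasureTheory Filter Topology

/-- The admissible sampling functions: `v` is `1`-periodic, continuous on `[0,1)`, `v(0) = 0`,
`v(1-0) = 1`, and `γm (y - x) ≤ v y - v x ≤ γp (y - x)` for `0 ≤ x ≤ y < 1`, where
`γm, γp > 0`. -/
structure IsMonotonePotential (v : ℝ → ℝ) (γm γp : ℝ) : Prop where
  periodic : Function.Periodic v 1
  continuousOn : ContinuousOn v (Set.Ico 0 1)
  map_zero : v 0 = 0
  tendsto_one : Tendsto v (𝓝[<] 1) (𝓝 1)
  gamma_minus_pos : 0 < γm
  gamma_plus_pos : 0 < γp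
  lower : ∀ x y : ℝ, 0 ≤ x → x ≤ y → y < 1 → γm * (y - x) ≤ v y - v x
  upper : ∀ x y : ℝ, 0 ≤ x → x ≤ y → y < 1 → v y - v x ≤ γp * (y - x)

theorem IsMonotonePotential.abs_le_one {v : ℝ → ℝ} {γm γp : ℝ}
    (hv : IsMonotonePotential v γm γp) (x : ℝ) : |v x| ≤ 1 := by
  have hx : v x = v (Int.fract x) := by
    have h := hv.periodic.sub_int_mul_eq (x := x) ⌊x⌋
    rw [mul_one] at h
    exact h.symm
  have h0 : 0 ≤ Int.fract x := Int.fract_nonneg x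
  have h1 : Int.fract x < 1 := Int.fract_lt_one x
  rw [hx, abs_of_nonneg]
  · refine ge_of_tendsto hv.tendsto_one ?_
    filter_upwards [Ioo_mem_nhdsLT h1] with y hy
    have h := hv.lower (Int.fract x) y h0 hy.1.le hy.2
    have h' := mul_nonneg hv.gamma_minus_pos.le (sub_nonneg.2 hy.1.le)
    linarith
  · have h := hv.lower 0 (Int.fract x) le_rfl h0 h1
    have h' := mul_nonneg hv.gamma_minus_pos.le (sub_nonneg.2 h0)
    rw [hv.map_zero] at h
    linarith

/-- The Hilbert space `ℓ²(ℤ)`. -/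
abbrev EllTwo : Type := lp (fun _ : ℤ => ℂ) 2

/-- The translation `ψ ↦ ψ(· + k)` on `ℓ²(ℤ)`. -/
noncomputable def shiftOp (k : ℤ) : EllTwo →L[ℂ] EllTwo :=
  LinearMap.mkContinuous
    { toFun := fun ψ => ⟨fun m => ψ (m + k), by
        have h := (memℓp_gen_iff (by norm_num : 0 < (2 : ENNReal).toReal)).1 (lp.memℓp ψ)
        exact memℓp_gen ((Equiv.addRight k).summable_iff.2 h)⟩
      map_add' := fun _ _ => rfl
      map_smul' := fun _ _ => rfl }
    1 (fun ψ => by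
      have h2 : 0 < (2 : ENNReal).toReal := by norm_num
      rw [one_mul, lp.norm_eq_tsum_rpow h2, lp.norm_eq_tsum_rpow h2]
      exact le_of_eq (congrArg (· ^ (1 / (2 : ENNReal).toReal))
        ((Equiv.addRight k).tsum_eq (fun m => ‖ψ m‖ ^ (2 : ENNReal).toReal))))

/-- The multiplication operator `(V ψ)(m) = V(m) ψ(m)` on `ℓ²(ℤ)`, for a bounded real
sequence `V`. -/
noncomputable def mulOp (V : ℤ → ℝ) (C : ℝ) (hV : ∀ m, |V m| ≤ C) : EllTwo →L[ℂ] EllTwo :=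
  have hle : ∀ (ψ : EllTwo) (m : ℤ), ‖(V m : ℂ) * ψ m‖ ≤ ‖((C : ℂ) • ψ) m‖ := fun ψ m => by
    rw [lp.coeFn_smul, Pi.smul_apply, smul_eq_mul, norm_mul, norm_mul, Complex.norm_real,
      Complex.norm_real]
    exact mul_le_mul_of_nonneg_right ((hV m).trans (le_abs_self C)) (norm_nonneg _)
  LinearMap.mkContinuous
    { toFun := fun ψ => ⟨fun m => (V m : ℂ) * ψ m,
        (lp.memℓp ((C : ℂ) • ψ)).mono' (hle ψ)⟩
      map_add' := fun ψ φ => by ext m; exact mul_add _ _ _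
      map_smul' := fun c ψ => by ext m; exact mul_left_comm _ _ _ }
    |C| (fun ψ => by
      have h := lp.norm_mono (p := 2) (by norm_num)
        (x := (⟨fun m => (V m : ℂ) * ψ m, (lp.memℓp ((C : ℂ) • ψ)).mono' (hle ψ)⟩ : EllTwo))
        (y := (C : ℂ) • ψ) (hle ψ)
      rw [norm_smul, Complex.norm_real] at h
      exact h)

/-- The quasiperiodic Schrödinger operator on `ℓ²(ℤ)`,
`(H ψ)(m) = ψ(m+1) + ψ(m-1) + lam * v (x + m α) * ψ(m)`. -/
noncomputable def hamiltonian {v : ℝ → ℝ} {γm γp : ℝ} (hv : IsMonotonePotential v γm γp)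
    (α lam x : ℝ) : EllTwo →L[ℂ] EllTwo :=
  shiftOp 1 + shiftOp (-1) + mulOp (fun m => lam * v (x + m * α)) |lam| (fun m => by
    rw [abs_mul]
    exact mul_le_of_le_one_right (abs_nonneg _) (hv.abs_le_one _))

theorem hamiltonian_apply {v : ℝ → ℝ} {γm γp : ℝ} (hv : IsMonotonePotential v γm γp)
    (α lam x : ℝ) (ψ : EllTwo) (m : ℤ) :
    hamiltonian hv α lam x ψ m =
      ψ (m + 1) + ψ (m - 1) + ((lam * v (x + m * α) : ℝ) : ℂ) * ψ m := rfl

/-- The restriction of the operator to `ℓ²{0, …, n-1}` with periodic boundary conditions: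
`(H ψ)(m) = ψ((m+1) mod n) + ψ((m-1) mod n) + lam * v (x + m α) * ψ(m)`. -/
noncomputable def periodicRestriction (v : ℝ → ℝ) (α lam : ℝ) (n : ℕ) (x : ℝ) :
    Matrix (Fin n) (Fin n) ℝ :=
  Matrix.of fun m k =>
    (if ((k : ℕ) : ℤ) = (((m : ℕ) : ℤ) + 1) % (n : ℤ) then 1 else 0) +
    (if ((k : ℕ) : ℤ) = (((m : ℕ) : ℤ) - 1) % (n : ℤ) then 1 else 0) +
    (if k = m then lam * v (x + (m : ℕ) * α) else 0)

theorem periodicRestriction_isSelfAdjoint (v : ℝ → ℝ) (α lam : ℝ) (n : ℕ) (x : ℝ) :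
    IsSelfAdjoint (periodicRestriction v α lam n x) := by
  have key : ∀ a b : Fin n, ((b : ℕ) : ℤ) = (((a : ℕ) : ℤ) + 1) % (n : ℤ) ↔
      ((a : ℕ) : ℤ) = (((b : ℕ) : ℤ) - 1) % (n : ℤ) := by
    intro a b
    have ha : ((a : ℕ) : ℤ) % (n : ℤ) = (a : ℕ) :=
      Int.emod_eq_of_lt (by positivity) (by exact_mod_cast a.2)
    have hb : ((b : ℕ) : ℤ) % (n : ℤ) = (b : ℕ) :=
      Int.emod_eq_of_lt (by positivity) (by exact_mod_cast b.2)
    constructor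
    · intro h
      rw [h, Int.emod_sub_emod, add_sub_cancel_right, ha]
    · intro h
      rw [h, Int.emod_add_emod, sub_add_cancel, hb]
  ext a b
  have e : (if b = a then lam * v (x + (a : ℕ) * α) else 0) =
      (if a = b then lam * v (x + (b : ℕ) * α) else 0) := by
    by_cases hab : a = b
    · subst hab; rfl
    · rw [if_neg hab, if_neg (Ne.symm hab)]
  simp only [Matrix.star_apply, periodicRestriction, Matrix.of_apply, star_trivial, key b a,
    ← key a b, e]
  ring

/-- `N` is the density of states measure of the operator family: the locally finite Borel measure
on `ℝ` with `∫ f dN = lim (1/n) ∫_{[0,1)} tr f(H_n(x)) dx` for all continuous compactly supported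
`f`, where `H_n(x)` is the periodic restriction. -/
def IsDensityOfStates (v : ℝ → ℝ) (α lam : ℝ) (N : Measure ℝ) : Prop :=
  IsLocallyFiniteMeasure N ∧
  ∀ f : ℝ → ℝ, Continuous f → HasCompactSupport f →
    Tendsto (fun n : ℕ => (1 / (n : ℝ)) *
        ∫ x in Set.Ico (0 : ℝ) 1, (cfc f (periodicRestriction v α lam n x)).trace)
      atTop (𝓝 (∫ E, f E ∂N))

/-- The integrated density of states `N(E) = N((-∞, E])`. -/
noncomputable def integratedDOS (N : Measure ℝ) (E : ℝ) : ℝ := N.real (Set.Iic E)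

/-- `liminf q_{k-1} / q_{k+1}`, with `q_k` the denominators of the convergents of the continued
fraction expansion of `α` (and `q_0 = 1`). -/
noncomputable def erExponent (α : ℝ) : ℝ :=
  liminf (fun k : ℕ => (GenContFract.of α).dens k / (GenContFract.of α).dens (k + 2)) atTop

/-! On each period `v` increases with slope at least `γm`; it drops only at the integers. Replacing
the phase `x` by `x + c` therefore raises the quadratic form of the periodic restriction by at least
`lam * γm * c` on vectors vanishing at the sites whose phase crosses an integer. By a dimension
count, the number of eigenvalues `≤ E` at `x + c` exceeds the number `≤ E - lam * γm * c` at `x` by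
at most the number of crossings (`specTrace_indicator_add_le`). Averaging over `x ∈ [0,1)` removes
the shift by periodicity and leaves at most `n * c` crossings. So the averaged count per site grows
by at most `c` over an energy interval of length `lam * γm * c`, uniformly in `n`. This gives the
Lipschitz constant `1 / (lam * γm)`; since `0 ≤ er(α) ≤ 1/2`, it is at least as sharp as the stated
constant.

Existence of the limit comes from locality: away from the ends, diagonal entries of powers of the
restriction agree with those of the operator on `ℤ`, so moments converge with error `O(1/n)`. The
Weierstrass theorem extends this to continuous functions and the Riesz–Markov theorem supplies the
measure.

For the spectrum: if `H(x) - E` is bounded below, density of `ℤα + ℤ` and right-continuity of `v`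
carry the bound to finitely supported vectors at every phase. Then every periodic restriction has at
most two eigenvalues near `E`, and the measure vanishes there. Hence the spectrum carries a
probability measure absolutely continuous with respect to Lebesgue measure, and cannot be null. -/

/-! ### Eigenvalue counting for real symmetric matrices. -/

open Matrix in
theorem Matrix.IsHermitian.trace_cfc_eq_sum {ι : Type*} [Fintype ι] [DecidableEq ι]
    {A : Matrix ι ι ℝ} (hA : A.IsHermitian) (f : ℝ → ℝ) :
    (cfc f A).trace = ∑ i, f (hA.eigenvalues i) := by
  rw [hA.cfc_eq, Matrix.IsHermitian.cfc, Unitary.conjStarAlgAut_apply, Matrix.trace_mul_comm,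
    ← mul_assoc, Unitary.coe_star_mul_self, one_mul, Matrix.trace_diagonal]
  rfl

namespace Matrix.IsHermitian

variable {ι : Type*} [Fintype ι] [DecidableEq ι] {A : Matrix ι ι ℝ} (hA : A.IsHermitian)

/-- The coordinate of a vector along the `i`-th eigenvector. -/
noncomputable def eigenCoord (i : ι) (ψ : ι → ℝ) : ℝ := ⇑(hA.eigenvectorBasis i) ⬝ᵥ ψ

theorem eigenCoord_mulVec (i : ι) (ψ : ι → ℝ) :
    hA.eigenCoord i (A *ᵥ ψ) = hA.eigenvalues i * hA.eigenCoord i ψ := by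
  have h := hA.mulVec_eigenvectorBasis i
  unfold eigenCoord
  rw [dotProduct_mulVec, ← mulVec_transpose, show Aᵀ = A by simpa using hA.eq, h,
    smul_dotProduct]
  rfl

/-- Parseval's identity; together with `eigenCoord_mulVec` it diagonalizes the quadratic form of
`A`. -/
theorem sum_eigenCoord_mul (φ ψ : ι → ℝ) :
    ∑ i, hA.eigenCoord i φ * hA.eigenCoord i ψ = φ ⬝ᵥ ψ := by
  have h := hA.eigenvectorBasis.sum_inner_mul_inner (WithLp.toLp 2 φ) (WithLp.toLp 2 ψ)
  simp only [PiLp.inner_apply, RCLike.inner_apply, conj_trivial] at h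
  simp only [eigenCoord, dotProduct]
  rw [show ∑ i, φ i * ψ i = ∑ i, ψ i * φ i from Finset.sum_congr rfl fun _ _ => mul_comm _ _, ← h]
  refine Finset.sum_congr rfl fun i _ => ?_
  congr 1
  exact Finset.sum_congr rfl fun _ _ => mul_comm _ _

theorem eigenCoord_sub (i : ι) (φ ψ : ι → ℝ) :
    hA.eigenCoord i (φ - ψ) = hA.eigenCoord i φ - hA.eigenCoord i ψ := dotProduct_sub _ _ _

theorem eigenCoord_smul (i : ι) (c : ℝ) (ψ : ι → ℝ) :
    hA.eigenCoord i (c • ψ) = c * hA.eigenCoord i ψ := dotProduct_smul _ _ _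

end Matrix.IsHermitian

/-- Fewer linear conditions than dimensions have a nonzero common solution. -/
theorem exists_ne_zero_forall_dotProduct_eq_zero {ι κ : Type*} [Fintype ι] [Fintype κ]
    (l : κ → ι → ℝ) (h : Fintype.card κ < Fintype.card ι) :
    ∃ ψ : ι → ℝ, ψ ≠ 0 ∧ ∀ k, l k ⬝ᵥ ψ = 0 := by
  have hlt : Module.finrank ℝ (κ → ℝ) < Module.finrank ℝ (ι → ℝ) := by simpa using h
  have hker := LinearMap.ker_ne_bot_of_finrank_lt (f := Matrix.mulVecLin (Matrix.of l)) hlt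
  obtain ⟨ψ, hψ, h0⟩ := Submodule.exists_mem_ne_zero_of_ne_bot hker
  exact ⟨ψ, h0, fun k => congrFun hψ k⟩

namespace Matrix.IsHermitian

variable {ι : Type*} [Fintype ι] [DecidableEq ι] {A B : Matrix ι ι ℝ}

/-- If `B + δ ≤ A` as quadratic forms on the vectors vanishing on `P`, then `A` has at most `#P`
more eigenvalues below `E` than `B` has below `E - δ`. -/
theorem card_eigenvalues_le (hA : A.IsHermitian) (hB : B.IsHermitian) (P : Finset ι) (δ E : ℝ)
    (h : ∀ ψ : ι → ℝ, (∀ i ∈ P, ψ i = 0) →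
      ψ ⬝ᵥ (B *ᵥ ψ) + δ * (ψ ⬝ᵥ ψ) ≤ ψ ⬝ᵥ (A *ᵥ ψ)) :
    (Finset.univ.filter fun i => hA.eigenvalues i ≤ E).card ≤
      (Finset.univ.filter fun i => hB.eigenvalues i ≤ E - δ).card + P.card := by
  by_contra! hlt
  have hc := Finset.card_filter_add_card_filter_not (s := (Finset.univ : Finset ι))
    (fun i => hA.eigenvalues i ≤ E)
  rw [Finset.card_univ] at hc
  -- The conditions make `ψ` orthogonal to the eigenvectors of `A` above `E` and to those of `B` up
  -- to `E - δ`, and zero on `P`. Failure of the claim is exactly what makes them fewer than the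
  -- dimension.
  obtain ⟨ψ, h0, hψ⟩ := exists_ne_zero_forall_dotProduct_eq_zero
    (κ := {i // i ∈ Finset.univ.filter fun i => ¬ hA.eigenvalues i ≤ E} ⊕
      {i // i ∈ Finset.univ.filter fun i => hB.eigenvalues i ≤ E - δ} ⊕ {i // i ∈ P})
    (Sum.elim (fun i => ⇑(hA.eigenvectorBasis i))
      (Sum.elim (fun i => ⇑(hB.eigenvectorBasis i)) fun i => Pi.single (i : ι) 1)) (by
        simp only [Fintype.card_sum, Fintype.card_coe]; omega)
  have h1 : ∀ i, ¬ hA.eigenvalues i ≤ E → hA.eigenCoord i ψ = 0 := fun i hi =>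
    hψ (Sum.inl ⟨i, by simpa using hi⟩)
  have h2 : ∀ i, hB.eigenvalues i ≤ E - δ → hB.eigenCoord i ψ = 0 := fun i hi =>
    hψ (Sum.inr (Sum.inl ⟨i, by simpa using hi⟩))
  have h3 : ∀ i ∈ P, ψ i = 0 := fun i hi => by
    simpa using hψ (Sum.inr (Sum.inr ⟨i, hi⟩))
  have hle := h ψ h3
  -- The form of `A` is now at most `E`, while that of `B` is strictly above `E - δ`, against `hle`.
  have hAE : ψ ⬝ᵥ (A *ᵥ ψ) ≤ E * (ψ ⬝ᵥ ψ) := by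
    rw [← hA.sum_eigenCoord_mul ψ (A *ᵥ ψ), ← hA.sum_eigenCoord_mul ψ ψ, Finset.mul_sum]
    refine Finset.sum_le_sum fun i _ => ?_
    rw [hA.eigenCoord_mulVec]
    by_cases hi : hA.eigenvalues i ≤ E
    · nlinarith [mul_self_nonneg (hA.eigenCoord i ψ)]
    · simp [h1 i hi]
  have hBE : (E - δ) * (ψ ⬝ᵥ ψ) < ψ ⬝ᵥ (B *ᵥ ψ) := by
    rw [← hB.sum_eigenCoord_mul ψ (B *ᵥ ψ), ← hB.sum_eigenCoord_mul ψ ψ, Finset.mul_sum]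
    have hpos : 0 < ψ ⬝ᵥ ψ := by
      rw [lt_iff_le_and_ne]
      exact ⟨Finset.sum_nonneg fun i _ => mul_self_nonneg _, fun h => h0
        (dotProduct_self_eq_zero.1 h.symm)⟩
    rw [← hB.sum_eigenCoord_mul ψ ψ] at hpos
    obtain ⟨j, -, hj⟩ := (Finset.sum_pos_iff_of_nonneg fun i _ => mul_self_nonneg _).1 hpos
    refine Finset.sum_lt_sum (fun i _ => ?_) ⟨j, Finset.mem_univ _, ?_⟩
    · rw [hB.eigenCoord_mulVec]
      by_cases hi : hB.eigenvalues i ≤ E - δ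
      · simp [h2 i hi]
      · nlinarith [mul_self_nonneg (hB.eigenCoord i ψ)]
    · rw [hB.eigenCoord_mulVec]
      have : ¬ hB.eigenvalues j ≤ E - δ := fun hi => by simp [h2 j hi] at hj
      nlinarith
  linarith

/-- If `‖(A - E) ψ‖ ≥ ε ‖ψ‖` for the `ψ` vanishing on `P`, then `A` has at most `#P` eigenvalues
in `(E - ε, E + ε)`. -/
theorem card_eigenvalues_abs_sub_lt_le (hA : A.IsHermitian) (P : Finset ι) {E ε : ℝ}
    (h : ∀ ψ : ι → ℝ, (∀ i ∈ P, ψ i = 0) →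
      ε ^ 2 * (ψ ⬝ᵥ ψ) ≤ (A *ᵥ ψ - E • ψ) ⬝ᵥ (A *ᵥ ψ - E • ψ)) :
    (Finset.univ.filter fun i => |hA.eigenvalues i - E| < ε).card ≤ P.card := by
  by_contra! hlt
  have hc := Finset.card_filter_add_card_filter_not (s := (Finset.univ : Finset ι))
    (fun i => |hA.eigenvalues i - E| < ε)
  rw [Finset.card_univ] at hc
  -- `ψ` lies in the spectral subspace of `(E - ε, E + ε)`, where `‖(A - E) ψ‖ < ε ‖ψ‖`, and
  -- vanishes on `P`.
  obtain ⟨ψ, h0, hψ⟩ := exists_ne_zero_forall_dotProduct_eq_zero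
    (κ := {i // i ∈ Finset.univ.filter fun i => ¬ |hA.eigenvalues i - E| < ε} ⊕ {i // i ∈ P})
    (Sum.elim (fun i => ⇑(hA.eigenvectorBasis i)) fun i => Pi.single (i : ι) 1) (by
        simp only [Fintype.card_sum, Fintype.card_coe]; omega)
  have h1 : ∀ i, ¬ |hA.eigenvalues i - E| < ε → hA.eigenCoord i ψ = 0 := fun i hi =>
    hψ (Sum.inl ⟨i, by simpa using hi⟩)
  have h3 : ∀ i ∈ P, ψ i = 0 := fun i hi => by
    simpa using hψ (Sum.inr ⟨i, hi⟩)
  have hle := h ψ h3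
  have hpos : 0 < ψ ⬝ᵥ ψ := by
    rw [lt_iff_le_and_ne]
    exact ⟨Finset.sum_nonneg fun i _ => mul_self_nonneg _, fun h => h0
      (dotProduct_self_eq_zero.1 h.symm)⟩
  refine absurd hle (not_le.2 ?_)
  rw [← hA.sum_eigenCoord_mul ψ ψ] at hpos ⊢
  rw [← hA.sum_eigenCoord_mul, Finset.mul_sum]
  obtain ⟨j, -, hj⟩ := (Finset.sum_pos_iff_of_nonneg fun i _ => mul_self_nonneg _).1 hpos
  have hform : ∀ i, hA.eigenCoord i (A *ᵥ ψ - E • ψ) * hA.eigenCoord i (A *ᵥ ψ - E • ψ) =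
      |hA.eigenvalues i - E| ^ 2 * (hA.eigenCoord i ψ * hA.eigenCoord i ψ) := fun i => by
    rw [eigenCoord_sub, eigenCoord_smul, eigenCoord_mulVec, sq_abs]; ring
  refine Finset.sum_lt_sum (fun i _ => ?_) ⟨j, Finset.mem_univ _, ?_⟩
  · rw [hform]
    by_cases hi : |hA.eigenvalues i - E| < ε
    · exact mul_le_mul_of_nonneg_right (pow_le_pow_left₀ (abs_nonneg _) hi.le 2)
        (mul_self_nonneg _)
    · simp [h1 i hi]
  · rw [hform]
    have : |hA.eigenvalues j - E| < ε := by
      by_contra hi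
      simp [h1 j hi] at hj
    exact mul_lt_mul_of_pos_right (pow_lt_pow_left₀ this (abs_nonneg _) two_ne_zero) hj

/-- Every eigenvalue is bounded by the largest absolute row sum. -/
theorem abs_eigenvalues_le (hA : A.IsHermitian) {M : ℝ} (h : ∀ i, ∑ j, |A i j| ≤ M) (i : ι) :
    |hA.eigenvalues i| ≤ M := by
  have hne : (hA.eigenvectorBasis i : ι → ℝ) ≠ 0 := fun h0 => by
    have := hA.eigenvectorBasis.orthonormal.ne_zero i
    exact this (by ext j; exact congrFun h0 j)
  have hv : Module.End.HasEigenvalue (Matrix.toLin' A) (hA.eigenvalues i) :=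
    Module.End.hasEigenvalue_of_hasEigenvector (x := (hA.eigenvectorBasis i : ι → ℝ))
      ⟨Module.End.mem_eigenspace_iff.2 (by
        rw [Matrix.toLin'_apply]; exact hA.mulVec_eigenvectorBasis i), hne⟩
  -- Gershgorin's circle theorem.
  obtain ⟨k, hk⟩ := eigenvalue_mem_ball hv
  rw [Metric.mem_closedBall, Real.dist_eq] at hk
  refine le_trans ?_ (h k)
  rw [← Finset.add_sum_erase _ _ (Finset.mem_univ k)]
  simp only [Real.norm_eq_abs] at hk
  have := abs_sub_abs_le_abs_sub (hA.eigenvalues i) (A k k)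
  linarith

end Matrix.IsHermitian

/-! ### The continued fraction exponent. -/

/-- The exponent `liminf q_k / q_{k+2}` of an irrational number lies in `[0, 1/2]`. -/
theorem erExponent_mem_Icc {α : ℝ} (hα : Irrational α) : erExponent α ∈ Set.Icc (0 : ℝ) (1 / 2) := by
  have hT : ∀ n, ¬ (GenContFract.of α).TerminatedAt n := fun n hn => by
    obtain ⟨q, hq⟩ := (GenContFract.terminates_iff_rat α).1 ⟨n, hn⟩
    exact hα ⟨q, hq.symm⟩
  have h0 : ∀ k, 0 ≤ (GenContFract.of α).dens k / (GenContFract.of α).dens (k + 2) := fun k =>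
    div_nonneg GenContFract.zero_le_of_den GenContFract.zero_le_of_den
  have h1 : ∀ k, (GenContFract.of α).dens k / (GenContFract.of α).dens (k + 2) ≤ 1 / 2 := by
    intro k
    obtain ⟨gp, hgp⟩ := Option.ne_none_iff_exists'.1 (hT (k + 1))
    have ha : gp.a = 1 := GenContFract.of_partNum_eq_one
      (GenContFract.partNum_eq_s_a hgp)
    have hb : 1 ≤ gp.b := GenContFract.of_one_le_get?_partDen
      (GenContFract.partDen_eq_s_b hgp)
    -- `q_{k+2} = b q_{k+1} + q_k` with `b ≥ 1` and `q_{k+1} ≥ q_k`, hence `q_{k+2} ≥ 2 q_k`.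
    have hrec := GenContFract.dens_recurrence hgp rfl rfl
    rw [ha, one_mul] at hrec
    have hm : (GenContFract.of α).dens k ≤ (GenContFract.of α).dens (k + 1) :=
      GenContFract.of_den_mono
    have hk : 0 ≤ (GenContFract.of α).dens (k + 1) := GenContFract.zero_le_of_den
    have hk' : 0 ≤ (GenContFract.of α).dens k := GenContFract.zero_le_of_den
    refine div_le_of_le_mul₀ GenContFract.zero_le_of_den (by norm_num) ?_
    nlinarith
  have hb : IsBoundedUnder (· ≥ ·) atTop
      fun k : ℕ => (GenContFract.of α).dens k / (GenContFract.of α).dens (k + 2) :=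
    isBoundedUnder_of ⟨0, h0⟩
  have hc : IsBoundedUnder (· ≤ ·) atTop
      fun k : ℕ => (GenContFract.of α).dens k / (GenContFract.of α).dens (k + 2) :=
    isBoundedUnder_of ⟨1 / 2, h1⟩
  exact ⟨le_liminf_of_le hc.isCoboundedUnder_ge (Eventually.of_forall h0),
    liminf_le_of_le hb fun b hb => by obtain ⟨k, hk⟩ := hb.exists; exact hk.trans (h1 k)⟩

/-! ### Regularity and increments of the potential. -/

namespace IsMonotonePotential

variable {v : ℝ → ℝ} {γm γp : ℝ}

theorem apply_fract (hv : IsMonotonePotential v γm γp) (x : ℝ) : v (Int.fract x) = v x := by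
  have h := hv.periodic.sub_int_mul_eq (x := x) ⌊x⌋
  rwa [mul_one] at h

theorem measurable (hv : IsMonotonePotential v γm γp) : Measurable v := by
  classical
  have h : v = (Set.Ico (0 : ℝ) 1).piecewise v (fun _ => 0) ∘ Int.fract := by
    funext x
    rw [Function.comp_apply, Set.piecewise_eq_of_mem _ _ _
      (show Int.fract x ∈ Set.Ico (0 : ℝ) 1 from ⟨Int.fract_nonneg x, Int.fract_lt_one x⟩),
      hv.apply_fract]
  rw [h]
  exact (hv.continuousOn.measurable_piecewise continuousOn_const measurableSet_Ico).comp
    measurable_fract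

/-- The potential is right-continuous everywhere. -/
theorem continuousWithinAt_Ici (hv : IsMonotonePotential v γm γp) (x : ℝ) :
    ContinuousWithinAt v (Set.Ici x) x := by
  have h0 : ContinuousWithinAt v (Set.Ici (Int.fract x)) (Int.fract x) := by
    refine (hv.continuousOn _ ⟨Int.fract_nonneg x, Int.fract_lt_one x⟩).mono_of_mem_nhdsWithin ?_
    filter_upwards [self_mem_nhdsWithin,
      mem_nhdsWithin_of_mem_nhds (Iio_mem_nhds (Int.fract_lt_one x))] with y hy hy'
    exact ⟨(Int.fract_nonneg x).trans hy, hy'⟩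
  have h1 : v = v ∘ fun y => y - ⌊x⌋ := by
    funext y
    have h := hv.periodic.sub_int_mul_eq (x := y) ⌊x⌋
    rw [mul_one] at h
    exact h.symm
  rw [h1]
  refine ContinuousWithinAt.comp (t := Set.Ici (Int.fract x)) h0 (by fun_prop) fun y hy => ?_
  exact sub_le_sub_right (Set.mem_Ici.1 hy) _

/-- The condition on the fractional part says that moving from `x` to `x + c` crosses no jump, so
both points reduce to the same period. -/
theorem fract_add_lt_one_increment (hv : IsMonotonePotential v γm γp) {x c : ℝ} (hc : 0 ≤ c)
    (h : Int.fract x + c < 1) : γm * c ≤ v (x + c) - v x := by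
  have h1 : v (x + c) = v (Int.fract x + c) := by
    have h := hv.periodic.sub_int_mul_eq (x := x + c) ⌊x⌋
    rw [mul_one] at h
    rw [← h, Int.fract]
    congr 1; ring
  have := hv.lower (Int.fract x) (Int.fract x + c) (Int.fract_nonneg x) (by linarith) h
  rw [h1, ← hv.apply_fract x]
  simpa using this

end IsMonotonePotential

/-! ### The periodic restriction and its averaged traces. -/

section Restriction

variable {v : ℝ → ℝ} {γm γp α lam : ℝ} {n : ℕ}

theorem periodicRestriction_isHermitian (v : ℝ → ℝ) (α lam : ℝ) (n : ℕ) (x : ℝ) :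
    (periodicRestriction v α lam n x).IsHermitian :=
  periodicRestriction_isSelfAdjoint v α lam n x

theorem periodicRestriction_mulVec (v : ℝ → ℝ) (α lam : ℝ) (x : ℝ) (ψ : ℤ → ℝ) (j : Fin n) :
    (periodicRestriction v α lam n x).mulVec (fun k => ψ (k : ℕ)) j =
      ψ (((j : ℕ) + 1 : ℤ) % n) + ψ (((j : ℕ) - 1 : ℤ) % n) +
        lam * v (x + (j : ℕ) * α) * ψ (j : ℕ) := by
  have hn : (0 : ℤ) < n := by have := j.2; omega
  have key : ∀ a : ℤ, ∑ k : Fin n, (if ((k : ℕ) : ℤ) = a % n then (1 : ℝ) else 0) * ψ (k : ℕ) =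
      ψ (a % n) := fun a => by
    have ha := Int.emod_nonneg a hn.ne'
    have ha' := Int.emod_lt_of_pos a hn
    rw [Finset.sum_eq_single (⟨(a % n).toNat, by omega⟩ : Fin n)]
    · simp [Int.toNat_of_nonneg ha]
    · intro b _ hb
      rw [if_neg, zero_mul]
      intro h
      exact hb (Fin.ext (by simp [← h]))
    · simp
  simp only [Matrix.mulVec, dotProduct, periodicRestriction, Matrix.of_apply, add_mul,
    Finset.sum_add_distrib, key]
  simp

theorem periodicRestriction_eq_add_diagonal (v : ℝ → ℝ) (α lam : ℝ) (n : ℕ) (x : ℝ) :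
    periodicRestriction v α lam n x = periodicRestriction 0 α lam n x +
      Matrix.diagonal fun m : Fin n => lam * v (x + (m : ℕ) * α) := by
  ext i j
  by_cases h : j = i
  · subst h; simp [periodicRestriction]
  · simp [periodicRestriction, h, Ne.symm h]

/-- The phase enters only through the diagonal, so the hopping terms cancel. -/
theorem dotProduct_periodicRestriction_sub (v : ℝ → ℝ) (α lam : ℝ) (n : ℕ) (x y : ℝ)
    (ψ : Fin n → ℝ) :
    ψ ⬝ᵥ (periodicRestriction v α lam n y).mulVec ψ -
      ψ ⬝ᵥ (periodicRestriction v α lam n x).mulVec ψ =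
      ∑ m : Fin n, lam * (v (y + (m : ℕ) * α) - v (x + (m : ℕ) * α)) * ψ m ^ 2 := by
  have h0 : periodicRestriction 0 α lam n y = periodicRestriction 0 α lam n x := by
    ext i j; simp [periodicRestriction]
  rw [periodicRestriction_eq_add_diagonal v α lam n y,
    periodicRestriction_eq_add_diagonal v α lam n x, h0, Matrix.add_mulVec, Matrix.add_mulVec,
    dotProduct_add, dotProduct_add, add_sub_add_left_eq_sub]
  simp only [dotProduct, Matrix.mulVec_diagonal, ← Finset.sum_sub_distrib]
  exact Finset.sum_congr rfl fun _ _ => by ring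

/-- With Gershgorin's theorem this confines all eigenvalues to `[-(2 + lam), 2 + lam]`, for every
size and phase. -/
theorem IsMonotonePotential.sum_abs_periodicRestriction_le (hv : IsMonotonePotential v γm γp)
    (hlam : 0 < lam) (x : ℝ) (i : Fin n) :
    ∑ j, |periodicRestriction v α lam n x i j| ≤ 2 + lam := by
  have key : ∀ a : ℤ, ∑ k : Fin n, (if ((k : ℕ) : ℤ) = a then (1 : ℝ) else 0) ≤ 1 := fun a => by
    rw [Finset.sum_boole]
    exact_mod_cast Finset.card_le_one.2 fun b hb c hc => by
      simp only [Finset.mem_filter] at hb hc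
      exact Fin.ext (by omega)
  have hle : ∀ j, |periodicRestriction v α lam n x i j| ≤
      (if ((j : ℕ) : ℤ) = (((i : ℕ) : ℤ) + 1) % (n : ℤ) then 1 else 0) +
      (if ((j : ℕ) : ℤ) = (((i : ℕ) : ℤ) - 1) % (n : ℤ) then 1 else 0) +
      (if j = i then lam else 0) := fun j => by
    refine (abs_add_le _ _).trans (add_le_add ((abs_add_le _ _).trans (add_le_add ?_ ?_)) ?_)
    · split_ifs <;> simp
    · split_ifs <;> simp
    · split_ifs
      · rw [abs_mul, abs_of_pos hlam]
        exact mul_le_of_le_one_right hlam.le (hv.abs_le_one _)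
      · simp
  refine (Finset.sum_le_sum fun j _ => hle j).trans ?_
  rw [Finset.sum_add_distrib, Finset.sum_add_distrib, Finset.sum_ite_eq' Finset.univ i]
  have h1 := key ((((i : ℕ) : ℤ) + 1) % (n : ℤ))
  have h2 := key ((((i : ℕ) : ℤ) - 1) % (n : ℤ))
  rw [if_pos (Finset.mem_univ i)]
  linarith

theorem IsMonotonePotential.sum_abs_periodicRestriction_pow_le (hv : IsMonotonePotential v γm γp)
    (hlam : 0 < lam) (x : ℝ) (p : ℕ) (i : Fin n) :
    ∑ j, |(periodicRestriction v α lam n x ^ p) i j| ≤ (2 + lam) ^ p := by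
  induction p generalizing i with
  | zero => simp [Matrix.one_apply, apply_ite]
  | succ p ih =>
    calc ∑ j, |(periodicRestriction v α lam n x ^ (p + 1)) i j|
        ≤ ∑ j, ∑ k, |periodicRestriction v α lam n x i k| *
            |(periodicRestriction v α lam n x ^ p) k j| := by
          refine Finset.sum_le_sum fun j _ => ?_
          rw [pow_succ', Matrix.mul_apply]
          refine (Finset.abs_sum_le_sum_abs _ _).trans (le_of_eq ?_)
          exact Finset.sum_congr rfl fun k _ => abs_mul _ _
      _ = ∑ k, |periodicRestriction v α lam n x i k| *
            ∑ j, |(periodicRestriction v α lam n x ^ p) k j| := by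
          rw [Finset.sum_comm]
          exact Finset.sum_congr rfl fun k _ => (Finset.mul_sum _ _ _).symm
      _ ≤ ∑ k, |periodicRestriction v α lam n x i k| * (2 + lam) ^ p :=
          Finset.sum_le_sum fun k _ => mul_le_mul_of_nonneg_left (ih k) (abs_nonneg _)
      _ ≤ (2 + lam) ^ (p + 1) := by
          rw [← Finset.sum_mul, pow_succ']
          exact mul_le_mul_of_nonneg_right (hv.sum_abs_periodicRestriction_le hlam x i)
            (by positivity)

/-- The trace of a function of the periodic restriction. -/
noncomputable def specTrace (v : ℝ → ℝ) (α lam : ℝ) (n : ℕ) (f : ℝ → ℝ) (x : ℝ) : ℝ :=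
  (cfc f (periodicRestriction v α lam n x)).trace

/-- The averaged trace per site of a function of the periodic restriction. -/
noncomputable def avgTrace (v : ℝ → ℝ) (α lam : ℝ) (f : ℝ → ℝ) (n : ℕ) : ℝ :=
  (1 / (n : ℝ)) * ∫ x in Set.Ico (0 : ℝ) 1, specTrace v α lam n f x

theorem specTrace_eq_sum (v : ℝ → ℝ) (α lam : ℝ) (n : ℕ) (f : ℝ → ℝ) (x : ℝ) :
    specTrace v α lam n f x =
      ∑ i, f ((periodicRestriction_isHermitian v α lam n x).eigenvalues i) :=
  Matrix.IsHermitian.trace_cfc_eq_sum _ f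

theorem specTrace_add (v : ℝ → ℝ) (α lam : ℝ) (n : ℕ) (f g : ℝ → ℝ) (x : ℝ) :
    specTrace v α lam n (f + g) x = specTrace v α lam n f x + specTrace v α lam n g x := by
  simp only [specTrace_eq_sum, Pi.add_apply, Finset.sum_add_distrib]

theorem specTrace_smul (v : ℝ → ℝ) (α lam : ℝ) (n : ℕ) (c : ℝ) (f : ℝ → ℝ) (x : ℝ) :
    specTrace v α lam n (c • f) x = c * specTrace v α lam n f x := by
  simp only [specTrace_eq_sum, Pi.smul_apply, smul_eq_mul, Finset.mul_sum]

theorem specTrace_const (v : ℝ → ℝ) (α lam : ℝ) (n : ℕ) (c x : ℝ) :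
    specTrace v α lam n (fun _ => c) x = n * c := by
  simp [specTrace_eq_sum]

theorem IsMonotonePotential.specTrace_le (hv : IsMonotonePotential v γm γp) (hlam : 0 < lam)
    {f g : ℝ → ℝ} (h : ∀ t ∈ Set.Icc (-(2 + lam)) (2 + lam), f t ≤ g t) (x : ℝ) :
    specTrace v α lam n f x ≤ specTrace v α lam n g x := by
  rw [specTrace_eq_sum, specTrace_eq_sum]
  exact Finset.sum_le_sum fun i _ => h _ (abs_le.1 (Matrix.IsHermitian.abs_eigenvalues_le _
    (fun i => hv.sum_abs_periodicRestriction_le hlam x i) i))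

theorem IsMonotonePotential.specTrace_periodic (hv : IsMonotonePotential v γm γp) (f : ℝ → ℝ) :
    Function.Periodic (specTrace v α lam n f) 1 := fun x => by
  have : periodicRestriction v α lam n (x + 1) = periodicRestriction v α lam n x := by
    ext i j
    simp only [periodicRestriction, Matrix.of_apply, add_right_comm x 1, hv.periodic _]
  simp only [specTrace, this]

theorem IsMonotonePotential.measurable_periodicRestriction_pow
    (hv : IsMonotonePotential v γm γp) (p : ℕ) (i j : Fin n) :
    Measurable fun x => (periodicRestriction v α lam n x ^ p) i j := by
  induction p generalizing i j with
  | zero => simp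
  | succ p ih =>
    simp only [pow_succ, Matrix.mul_apply]
    refine Finset.measurable_sum _ fun k _ => (ih i k).mul ?_
    have := hv.measurable
    simp only [periodicRestriction, Matrix.of_apply]
    refine Measurable.add measurable_const ?_
    split_ifs
    · exact measurable_const.mul (this.comp (measurable_id.add_const _))
    · exact measurable_const

theorem specTrace_pow (v : ℝ → ℝ) (α lam : ℝ) (n p : ℕ) (x : ℝ) :
    specTrace v α lam n (fun t => t ^ p) x = (periodicRestriction v α lam n x ^ p).trace := by
  rw [specTrace, cfc_pow_id _ _ (periodicRestriction_isSelfAdjoint v α lam n x)]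

/-- Traces of powers are polynomials in the matrix entries, so no measurable choice of eigenvalues
is needed; other functions follow by pointwise limits on `[-(2 + lam), 2 + lam]`. -/
theorem IsMonotonePotential.measurable_specTrace_polynomial (hv : IsMonotonePotential v γm γp)
    (P : Polynomial ℝ) : Measurable (specTrace v α lam n fun t => P.eval t) := by
  induction P using Polynomial.induction_on' with
  | add P Q hP hQ =>
    have h : (specTrace v α lam n fun t => (P + Q).eval t) = fun x =>
        specTrace v α lam n (fun t => P.eval t) x + specTrace v α lam n (fun t => Q.eval t) x := by
      funext x
      rw [← specTrace_add]
      congr 1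
      funext t
      simp
    rw [h]
    exact hP.add hQ
  | monomial p a =>
    have h : (specTrace v α lam n fun t => (Polynomial.monomial p a).eval t) = fun x =>
        a * ∑ i, (periodicRestriction v α lam n x ^ p) i i := by
      funext x
      rw [show ∑ i, (periodicRestriction v α lam n x ^ p) i i =
        (periodicRestriction v α lam n x ^ p).trace from rfl, ← specTrace_pow, ← specTrace_smul]
      congr 1
      funext t
      simp
    rw [h]
    exact measurable_const.mul (Finset.measurable_sum _ fun i _ =>
      hv.measurable_periodicRestriction_pow p i i)

theorem IsMonotonePotential.measurable_specTrace_of_tendsto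
    (hlam : 0 < lam) (hv : IsMonotonePotential v γm γp) {f : ℝ → ℝ} {g : ℕ → ℝ → ℝ}
    (hg : ∀ k, Measurable (specTrace v α lam n (g k)))
    (h : ∀ t ∈ Set.Icc (-(2 + lam)) (2 + lam), Tendsto (fun k => g k t) atTop (𝓝 (f t))) :
    Measurable (specTrace v α lam n f) := by
  refine measurable_of_tendsto_metrizable hg (tendsto_pi_nhds.2 fun x => ?_)
  simp only [specTrace_eq_sum]
  exact tendsto_finsetSum _ fun i _ => h _ (abs_le.1 (Matrix.IsHermitian.abs_eigenvalues_le _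
    (fun i => hv.sum_abs_periodicRestriction_le hlam x i) i))

theorem IsMonotonePotential.measurable_specTrace (hv : IsMonotonePotential v γm γp)
    (hlam : 0 < lam) {f : ℝ → ℝ} (hf : Continuous f) : Measurable (specTrace v α lam n f) := by
  choose P hP using fun k : ℕ => exists_polynomial_near_of_continuousOn (-(2 + lam)) (2 + lam) f
    hf.continuousOn (1 / ((k : ℝ) + 1)) (by positivity)
  refine hv.measurable_specTrace_of_tendsto hlam
    (fun k => hv.measurable_specTrace_polynomial (P k)) fun t ht => ?_
  rw [tendsto_iff_dist_tendsto_zero]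
  exact squeeze_zero (fun _ => dist_nonneg) (fun k => (hP k t ht).le)
    tendsto_one_div_add_atTop_nhds_zero_nat

theorem IsMonotonePotential.measurable_specTrace_Iic (hv : IsMonotonePotential v γm γp)
    (hlam : 0 < lam) (E : ℝ) :
    Measurable (specTrace v α lam n ((Set.Iic E).indicator 1)) := by
  -- Continuous ramps of slope `-k` starting at `E` decrease to the indicator.
  refine hv.measurable_specTrace_of_tendsto hlam
    (g := fun k t => max 0 (1 - k * max 0 (t - E)))
    (fun k => hv.measurable_specTrace hlam (by fun_prop)) fun t _ => ?_
  by_cases ht : t ≤ E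
  · rw [Set.indicator_of_mem (show t ∈ Set.Iic E from ht), max_eq_left (sub_nonpos.2 ht)]
    simp
  · rw [Set.indicator_of_notMem (show t ∉ Set.Iic E from ht)]
    push Not at ht
    refine tendsto_const_nhds.congr' ?_
    obtain ⟨K, hK⟩ := exists_nat_gt (1 / (t - E))
    filter_upwards [eventually_ge_atTop K] with k hk
    have hp : 0 < t - E := sub_pos.2 ht
    rw [div_lt_iff₀ hp] at hK
    have : (K : ℝ) ≤ k := by exact_mod_cast hk
    rw [max_eq_right hp.le, max_eq_left]
    nlinarith

theorem IsMonotonePotential.integrableOn_specTrace (hv : IsMonotonePotential v γm γp)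
    (hlam : 0 < lam) {f : ℝ → ℝ} {C : ℝ} (hf : Measurable (specTrace v α lam n f))
    (hC : ∀ t ∈ Set.Icc (-(2 + lam)) (2 + lam), |f t| ≤ C) :
    IntegrableOn (specTrace v α lam n f) (Set.Ico 0 1) := by
  refine Measure.integrableOn_of_bounded (M := n * C) (by simp) hf.aestronglyMeasurable
    (Eventually.of_forall fun x => ?_)
  rw [Real.norm_eq_abs, abs_le]
  constructor
  · rw [← mul_neg, ← specTrace_const v α lam n (-C) x]
    exact hv.specTrace_le hlam (fun t ht => (abs_le.1 (hC t ht)).1) x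
  · rw [← specTrace_const v α lam n C x]
    exact hv.specTrace_le hlam (fun t ht => (abs_le.1 (hC t ht)).2) x

theorem IsMonotonePotential.integrableOn_specTrace_of_continuous
    (hv : IsMonotonePotential v γm γp) (hlam : 0 < lam) {f : ℝ → ℝ} (hf : Continuous f) :
    IntegrableOn (specTrace v α lam n f) (Set.Ico 0 1) := by
  obtain ⟨C, hC⟩ := (isCompact_Icc (a := -(2 + lam)) (b := 2 + lam)).exists_bound_of_continuousOn
    hf.continuousOn
  exact hv.integrableOn_specTrace hlam (hv.measurable_specTrace hlam hf) hC

theorem avgTrace_const (v : ℝ → ℝ) (α lam c : ℝ) (hn : n ≠ 0) :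
    avgTrace v α lam (fun _ => c) n = c := by
  have : (n : ℝ) ≠ 0 := Nat.cast_ne_zero.2 hn
  simp only [avgTrace, specTrace_const]
  simp [this]

theorem IsMonotonePotential.avgTrace_le (hv : IsMonotonePotential v γm γp) (hlam : 0 < lam)
    {f g : ℝ → ℝ} (hf : Continuous f) (hg : Continuous g)
    (h : ∀ t ∈ Set.Icc (-(2 + lam)) (2 + lam), f t ≤ g t) (n : ℕ) :
    avgTrace v α lam f n ≤ avgTrace v α lam g n := by
  refine mul_le_mul_of_nonneg_left (setIntegral_mono_on
    (hv.integrableOn_specTrace_of_continuous hlam hf)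
    (hv.integrableOn_specTrace_of_continuous hlam hg) measurableSet_Ico fun x _ =>
      hv.specTrace_le hlam h x) (by positivity)

theorem IsMonotonePotential.avgTrace_add (hv : IsMonotonePotential v γm γp) (hlam : 0 < lam)
    {f g : ℝ → ℝ} (hf : Continuous f) (hg : Continuous g) (n : ℕ) :
    avgTrace v α lam (f + g) n = avgTrace v α lam f n + avgTrace v α lam g n := by
  simp only [avgTrace, specTrace_add]
  rw [integral_add (hv.integrableOn_specTrace_of_continuous hlam hf)
    (hv.integrableOn_specTrace_of_continuous hlam hg), mul_add]

theorem avgTrace_smul (v : ℝ → ℝ) (α lam c : ℝ) (f : ℝ → ℝ) (n : ℕ) :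
    avgTrace v α lam (c • f) n = c * avgTrace v α lam f n := by
  simp only [avgTrace, specTrace_smul, integral_const_mul]
  ring

theorem IsMonotonePotential.abs_avgTrace_sub_le (hv : IsMonotonePotential v γm γp)
    (hlam : 0 < lam) {f g : ℝ → ℝ} (hf : Continuous f) (hg : Continuous g) {ε : ℝ}
    (h : ∀ t ∈ Set.Icc (-(2 + lam)) (2 + lam), |f t - g t| ≤ ε) (hn : n ≠ 0) :
    |avgTrace v α lam f n - avgTrace v α lam g n| ≤ ε := by
  have h1 := hv.avgTrace_le (α := α) hlam hf (hg.add (continuous_const (y := ε)))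
    (fun t ht => by have := (abs_le.1 (h t ht)).2; simp only [Pi.add_apply]; linarith) n
  have h2 := hv.avgTrace_le (α := α) hlam hg (hf.add (continuous_const (y := ε)))
    (fun t ht => by have := (abs_le.1 (h t ht)).1; simp only [Pi.add_apply]; linarith) n
  rw [hv.avgTrace_add hlam hg continuous_const, avgTrace_const _ _ _ _ hn] at h1
  rw [hv.avgTrace_add hlam hf continuous_const, avgTrace_const _ _ _ _ hn] at h2
  rw [abs_le]
  constructor <;> linarith

end Restriction

/-! ### Locality and convergence of the moments. -/

/-- The Schrödinger difference expression with potential `V` on sequences over `ℤ`. -/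
def latticeStep (V : ℤ → ℝ) (ψ : ℤ → ℝ) : ℤ → ℝ := fun m => ψ (m + 1) + ψ (m - 1) + V m * ψ m

/-- Finite propagation speed: each step enlarges the support by one site on either side. -/
theorem iterate_latticeStep_eq_zero (V : ℤ → ℝ) (i : ℤ) (p : ℕ) {m : ℤ} (h : (p : ℤ) < |m - i|) :
    (latticeStep V)^[p] (Pi.single i 1) m = 0 := by
  induction p generalizing m with
  | zero =>
    rw [Function.iterate_zero_apply, Pi.single_apply, if_neg]
    rintro rfl
    simp at h
  | succ p ih =>
    rw [Function.iterate_succ_apply']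
    have h1 : (p : ℤ) < |m + 1 - i| := by grind
    have h2 : (p : ℤ) < |m - 1 - i| := by grind
    have h3 : (p : ℤ) < |m - i| := by push_cast at h; linarith
    simp only [latticeStep, ih h1, ih h2, ih h3]
    ring

theorem iterate_latticeStep_translate (V : ℤ → ℝ) (i : ℤ) (p : ℕ) (m : ℤ) :
    (latticeStep V)^[p] (Pi.single i 1) (m + i) =
      (latticeStep fun k => V (k + i))^[p] (Pi.single 0 1) m := by
  induction p generalizing m with
  | zero => simp [Pi.single_apply]
  | succ p ih =>
    simp only [Function.iterate_succ_apply', latticeStep]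
    rw [← ih, ← ih, ← ih, show m + i + 1 = m + 1 + i by ring, show m + i - 1 = m - 1 + i by ring]

theorem abs_iterate_latticeStep_le {V : ℤ → ℝ} {C : ℝ} (hV : ∀ m, |V m| ≤ C) (p : ℕ) (m : ℤ) :
    |(latticeStep V)^[p] (Pi.single 0 1) m| ≤ (2 + C) ^ p := by
  have hC : 0 ≤ C := (abs_nonneg _).trans (hV 0)
  induction p generalizing m with
  | zero =>
    rw [Function.iterate_zero_apply, Pi.single_apply]
    split_ifs <;> simp
  | succ p ih =>
    rw [Function.iterate_succ_apply', latticeStep, pow_succ']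
    refine (abs_add_le _ _).trans ((add_le_add (abs_add_le _ _) (abs_mul _ _).le).trans ?_)
    have := mul_le_mul (hV m) (ih m) (abs_nonneg _) hC
    linarith [ih (m + 1), ih (m - 1)]

section

variable {v : ℝ → ℝ} {γm γp α lam : ℝ} {n : ℕ}

/-- The potential sequence of the phase `x`. -/
noncomputable def phasePotential (v : ℝ → ℝ) (α lam x : ℝ) : ℤ → ℝ := fun m => lam * v (x + m * α)

/-- The diagonal entry at the origin of the `p`-th power of the operator on `ℤ`. -/
noncomputable def localMoment (v : ℝ → ℝ) (α lam : ℝ) (p : ℕ) (x : ℝ) : ℝ :=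
  (latticeStep (phasePotential v α lam x))^[p] (Pi.single 0 1) 0

/-- The wrap-around entries see only the values at `0` and `n - 1`, which vanish. -/
theorem periodicRestriction_mulVec_eq_latticeStep (v : ℝ → ℝ) (α lam : ℝ) (x : ℝ) {ψ : ℤ → ℝ}
    (h : ∀ m : ℤ, m < 1 ∨ (n : ℤ) - 1 ≤ m → ψ m = 0) :
    (periodicRestriction v α lam n x).mulVec (fun k => ψ (k : ℕ)) =
      fun j : Fin n => latticeStep (phasePotential v α lam x) ψ (j : ℕ) := by
  funext j
  have hj := j.2
  have hwrap : ∀ a : ℤ, -1 ≤ a → a ≤ n → ψ (a % n) = ψ a := fun a ha ha' => by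
    rcases eq_or_lt_of_le ha with rfl | ha
    · rw [h (-1) (by omega), show (-1 : ℤ) % n = n - 1 by
        rw [Int.emod_eq_iff (by omega)]
        refine ⟨by omega, by omega, by simp⟩]
      exact h _ (by omega)
    · rcases eq_or_lt_of_le ha' with rfl | ha'
      · rw [Int.emod_self, h 0 (by omega), h n (by omega)]
      · rw [Int.emod_eq_of_lt (by omega) ha']
  rw [periodicRestriction_mulVec, hwrap _ (by omega) (by omega), hwrap _ (by omega) (by omega)]
  simp [latticeStep, phasePotential]

/-- Before the last of `p` steps a walk from `i` has not reached sites `0` or `n - 1`, so it cannot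
detect the boundary condition. Translation covariance then moves `i` to the origin. -/
theorem periodicRestriction_pow_diag (v : ℝ → ℝ) (α lam : ℝ) (x : ℝ) {p : ℕ} {i : Fin n}
    (h1 : p ≤ (i : ℕ)) (h2 : (i : ℕ) + p < n) :
    (periodicRestriction v α lam n x ^ p) i i = localMoment v α lam p (x + (i : ℕ) * α) := by
  have key : ∀ q ≤ p, (periodicRestriction v α lam n x ^ q).mulVec (Pi.single i 1) =
      fun j : Fin n => (latticeStep (phasePotential v α lam x))^[q]
        (Pi.single ((i : ℕ) : ℤ) 1) (j : ℕ) := by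
    intro q hq
    induction q with
    | zero =>
      funext j
      simp [Matrix.one_apply, Pi.single_apply, Fin.ext_iff]
    | succ q ih =>
      rw [pow_succ', ← Matrix.mulVec_mulVec, ih (by omega),
        periodicRestriction_mulVec_eq_latticeStep]
      · simp only [Function.iterate_succ_apply']
      · intro m hm
        refine iterate_latticeStep_eq_zero _ _ _ ?_
        rw [lt_abs]
        omega
  have h := congrFun (key p le_rfl) i
  rw [Matrix.mulVec_single_one] at h
  have h' := iterate_latticeStep_translate (phasePotential v α lam x) (i : ℕ) p 0
  rw [zero_add] at h'
  rw [localMoment, show phasePotential v α lam (x + (i : ℕ) * α) =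
    fun k => phasePotential v α lam x (k + (i : ℕ)) from ?_, ← h', ← h]
  · rfl
  · funext k
    simp only [phasePotential]
    push_cast
    congr 2
    ring

theorem IsMonotonePotential.abs_phasePotential_le (hv : IsMonotonePotential v γm γp)
    (hlam : 0 < lam) (x : ℝ) (m : ℤ) : |phasePotential v α lam x m| ≤ lam := by
  rw [phasePotential, abs_mul, abs_of_pos hlam]
  exact mul_le_of_le_one_right hlam.le (hv.abs_le_one _)

theorem IsMonotonePotential.measurable_localMoment (hv : IsMonotonePotential v γm γp) (p : ℕ) :
    Measurable (localMoment v α lam p) := by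
  have h : ∀ m : ℤ, Measurable fun x =>
      (latticeStep (phasePotential v α lam x))^[p] (Pi.single 0 1) m := by
    induction p with
    | zero => intro m; exact measurable_const
    | succ p ih =>
      intro m
      simp only [Function.iterate_succ_apply', latticeStep]
      refine ((ih _).add (ih _)).add (Measurable.mul ?_ (ih m))
      exact measurable_const.mul (hv.measurable.comp (measurable_id.add_const _))
  exact h 0

theorem IsMonotonePotential.localMoment_periodic (hv : IsMonotonePotential v γm γp) (p : ℕ) :
    Function.Periodic (localMoment v α lam p) 1 := fun x => by
  have : phasePotential v α lam (x + 1) = phasePotential v α lam x := by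
    funext m
    simp only [phasePotential, add_right_comm x 1, hv.periodic _]
  simp only [localMoment, this]

theorem setIntegral_Ico_add_eq_of_periodic {f : ℝ → ℝ} (hf : Function.Periodic f 1) (c : ℝ) :
    ∫ x in Set.Ico (0 : ℝ) 1, f (x + c) = ∫ x in Set.Ico (0 : ℝ) 1, f x := by
  simp only [integral_Ico_eq_integral_Ioc, ← intervalIntegral.integral_of_le zero_le_one]
  rw [intervalIntegral.integral_comp_add_right, zero_add, add_comm 1 c,
    hf.intervalIntegral_add_eq c 0, zero_add]

theorem IsMonotonePotential.integrableOn_periodicRestriction_pow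
    (hv : IsMonotonePotential v γm γp) (hlam : 0 < lam) (p : ℕ) (i : Fin n) :
    IntegrableOn (fun x => (periodicRestriction v α lam n x ^ p) i i) (Set.Ico 0 1) :=
  Measure.integrableOn_of_bounded (M := (2 + lam) ^ p) (by simp)
    (hv.measurable_periodicRestriction_pow p i i).aestronglyMeasurable
    (Eventually.of_forall fun x => (Finset.single_le_sum
      (f := fun j => |(periodicRestriction v α lam n x ^ p) i j|) (fun _ _ => abs_nonneg _)
      (Finset.mem_univ i)).trans (hv.sum_abs_periodicRestriction_pow_le hlam x p i))

/-- After averaging over the phase every interior site contributes exactly the same limit `L`. At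
most `2 * p` sites are near the ends, each with error at most `2 * (2 + lam) ^ p`. -/
theorem IsMonotonePotential.abs_avgTrace_pow_sub_le (hv : IsMonotonePotential v γm γp)
    (hlam : 0 < lam) (p : ℕ) (hn : n ≠ 0) :
    |avgTrace v α lam (fun t => t ^ p) n - ∫ x in Set.Ico (0 : ℝ) 1, localMoment v α lam p x| ≤
      4 * p * (2 + lam) ^ p / n := by
  set L := ∫ x in Set.Ico (0 : ℝ) 1, localMoment v α lam p x with hL
  have hn' : (0 : ℝ) < n := by positivity
  have hLi : ∀ i : Fin n,
      ∫ x in Set.Ico (0 : ℝ) 1, localMoment v α lam p (x + (i : ℕ) * α) = L := fun i =>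
    setIntegral_Ico_add_eq_of_periodic (hv.localMoment_periodic p) _
  set D : Fin n → ℝ := fun i =>
    ∫ x in Set.Ico (0 : ℝ) 1, (periodicRestriction v α lam n x ^ p) i i with hD
  have hDL : ∀ i, |D i - L| ≤ 2 * (2 + lam) ^ p := fun i => by
    have h1 : |D i| ≤ (2 + lam) ^ p := by
      have := norm_setIntegral_le_of_norm_le_const (μ := volume) (s := Set.Ico (0 : ℝ) 1)
        (f := fun x => (periodicRestriction v α lam n x ^ p) i i) (C := (2 + lam) ^ p) (by simp)
        fun x _ => (Finset.single_le_sum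
          (f := fun j => |(periodicRestriction v α lam n x ^ p) i j|) (fun _ _ => abs_nonneg _)
          (Finset.mem_univ i)).trans (hv.sum_abs_periodicRestriction_pow_le hlam x p i)
      simpa using this
    have h2 : |L| ≤ (2 + lam) ^ p := by
      have := norm_setIntegral_le_of_norm_le_const (μ := volume) (s := Set.Ico (0 : ℝ) 1)
        (f := localMoment v α lam p) (C := (2 + lam) ^ p) (by simp)
        fun x _ => abs_iterate_latticeStep_le (hv.abs_phasePotential_le hlam x) p 0
      simpa using this
    exact (abs_sub _ _).trans (by linarith)
  have hzero : ∀ i : Fin n, p ≤ (i : ℕ) ∧ (i : ℕ) + p < n → D i - L = 0 := fun i hi => by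
    rw [sub_eq_zero, ← hLi i]
    exact integral_congr_ae (Eventually.of_forall fun x =>
      periodicRestriction_pow_diag v α lam x hi.1 hi.2)
  have hsum : avgTrace v α lam (fun t => t ^ p) n - L = (∑ i, (D i - L)) / n := by
    have : ∫ x in Set.Ico (0 : ℝ) 1, specTrace v α lam n (fun t => t ^ p) x = ∑ i, D i := by
      rw [hD, ← integral_finsetSum _ fun i _ => hv.integrableOn_periodicRestriction_pow hlam p i]
      simp only [specTrace_pow]
      rfl
    rw [avgTrace, this, Finset.sum_sub_distrib]
    simp
    field_simp
  rw [hsum, abs_div, abs_of_pos hn']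
  gcongr
  -- Exceptional sites lie in the first or last `p` positions; for `p > n` the truncated `n - p` is
  -- `0` and all sites are covered.
  have hcard : ((Finset.univ.filter fun i : Fin n => ¬ (p ≤ (i : ℕ) ∧ (i : ℕ) + p < n)).card : ℝ)
      ≤ 2 * p := by
    have hsub : (Finset.univ.filter fun i : Fin n => ¬ (p ≤ (i : ℕ) ∧ (i : ℕ) + p < n)).card ≤
        (Finset.range p ∪ Finset.Ico (n - p) n).card := by
      refine Finset.card_le_card_of_injOn (fun i => (i : ℕ)) (fun i hi => ?_)
        Fin.val_injective.injOn
      have hi' := i.2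
      simp only [Finset.coe_filter, Set.mem_ofPred_eq, Finset.mem_univ, true_and] at hi
      simp only [Finset.coe_union, Finset.coe_range, Finset.coe_Ico, Set.mem_union, Set.mem_Iio,
        Set.mem_Ico]
      omega
    have := hsub.trans (Finset.card_union_le _ _)
    rw [Finset.card_range, Nat.card_Ico] at this
    exact_mod_cast this.trans (by omega)
  calc |∑ i, (D i - L)| ≤ ∑ i, |D i - L| := Finset.abs_sum_le_sum_abs _ _
    _ = ∑ i ∈ Finset.univ.filter fun i : Fin n => ¬ (p ≤ (i : ℕ) ∧ (i : ℕ) + p < n), |D i - L| := by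
        symm
        apply Finset.sum_filter_of_ne
        intro i _ hi hcon
        apply hi
        rw [hzero i hcon, abs_zero]
    _ ≤ _ := by
        refine (Finset.sum_le_card_nsmul _ _ _ fun i _ => hDL i).trans ?_
        rw [nsmul_eq_mul]
        have : (0 : ℝ) ≤ (2 + lam) ^ p := by positivity
        nlinarith

/-! ### Existence and uniqueness of the density of states. -/

theorem IsMonotonePotential.exists_tendsto_avgTrace_polynomial
    (hv : IsMonotonePotential v γm γp) (α : ℝ) (hlam : 0 < lam) (P : Polynomial ℝ) :
    ∃ L, Tendsto (avgTrace v α lam fun t => P.eval t) atTop (𝓝 L) := by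
  induction P using Polynomial.induction_on' with
  | add P Q hP hQ =>
    obtain ⟨L, hL⟩ := hP
    obtain ⟨L', hL'⟩ := hQ
    refine ⟨L + L', (hL.add hL').congr fun n => ?_⟩
    rw [← hv.avgTrace_add hlam P.continuous Q.continuous]
    congr 1
    funext t
    simp
  | monomial p a =>
    refine ⟨a * ∫ x in Set.Ico (0 : ℝ) 1, localMoment v α lam p x, ?_⟩
    have h1 : (avgTrace v α lam fun t => (Polynomial.monomial p a).eval t) =
        fun n => a * avgTrace v α lam (fun t => t ^ p) n := by
      funext n
      rw [← avgTrace_smul]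
      congr 1
      funext t
      simp
    rw [h1]
    refine Tendsto.const_mul a ?_
    rw [tendsto_iff_dist_tendsto_zero]
    refine squeeze_zero' (Eventually.of_forall fun _ => dist_nonneg) ?_
      (tendsto_const_div_atTop_nhds_zero_nat (4 * p * (2 + lam) ^ p))
    filter_upwards [eventually_ne_atTop 0] with n hn
    exact hv.abs_avgTrace_pow_sub_le hlam p hn

theorem IsMonotonePotential.exists_tendsto_avgTrace (hv : IsMonotonePotential v γm γp) (α : ℝ)
    (hlam : 0 < lam) {f : ℝ → ℝ} (hf : Continuous f) :
    ∃ L, Tendsto (avgTrace v α lam f) atTop (𝓝 L) := by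
  refine cauchySeq_tendsto_of_complete (Metric.cauchySeq_iff'.2 fun ε hε => ?_)
  -- Uniform approximation on the interval containing every spectrum changes each average by at most
  -- `ε / 4`, so the Cauchy property passes from `P` to `f`.
  obtain ⟨P, hP⟩ := exists_polynomial_near_of_continuousOn (-(2 + lam)) (2 + lam) f
    hf.continuousOn (ε / 4) (by positivity)
  obtain ⟨L, hL⟩ := hv.exists_tendsto_avgTrace_polynomial α hlam P
  obtain ⟨K, hK⟩ := Metric.cauchySeq_iff.1 hL.cauchySeq (ε / 4) (by positivity)
  have key : ∀ n, n ≠ 0 → |avgTrace v α lam (fun t => P.eval t) n - avgTrace v α lam f n| ≤ ε / 4 :=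
    fun n hn => hv.abs_avgTrace_sub_le hlam P.continuous hf (fun t ht => (hP t ht).le) hn
  refine ⟨K + 1, fun n hn => ?_⟩
  have h1 := abs_le.1 (key n (by omega))
  have h2 := abs_le.1 (key (K + 1) (by omega))
  have h3 := abs_lt.1 (hK n (by omega) (K + 1) (by omega))
  rw [Real.dist_eq, abs_lt]
  constructor <;> linarith

open CompactlySupported in
-- The limits define a positive linear functional on compactly supported functions, which
-- Riesz–Markov represents by a measure.
theorem IsMonotonePotential.exists_isDensityOfStates (hv : IsMonotonePotential v γm γp) (α : ℝ)
    (hlam : 0 < lam) : ∃ N, IsDensityOfStates v α lam N := by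
  choose L hL using fun f : C_c(ℝ, ℝ) => hv.exists_tendsto_avgTrace α hlam f.continuous
  let Λ₀ : C_c(ℝ, ℝ) →ₗ[ℝ] ℝ :=
    { toFun := L
      map_add' := fun f g => tendsto_nhds_unique (hL (f + g))
        (((hL f).add (hL g)).congr fun n =>
          (hv.avgTrace_add hlam f.continuous g.continuous n).symm)
      map_smul' := fun c f => tendsto_nhds_unique (hL (c • f))
        (((hL f).const_mul c).congr fun n => (avgTrace_smul v α lam c f n).symm) }
  let Λ : C_c(ℝ, ℝ) →ₚ[ℝ] ℝ := PositiveLinearMap.mk₀ Λ₀ fun f hf => by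
    refine ge_of_tendsto (hL f) ?_
    filter_upwards [eventually_ne_atTop 0] with n hn
    rw [← avgTrace_const (n := n) v α lam 0 hn]
    exact hv.avgTrace_le hlam continuous_const f.continuous (fun t _ => hf t) n
  refine ⟨RealRMK.rieszMeasure Λ, inferInstance, fun f hf hfc => ?_⟩
  have h := RealRMK.integral_rieszMeasure Λ ⟨⟨f, hf⟩, hfc⟩
  have h' : ∫ x, f x ∂(RealRMK.rieszMeasure Λ) = L ⟨⟨f, hf⟩, hfc⟩ := h
  rw [h']
  exact hL ⟨⟨f, hf⟩, hfc⟩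

theorem IsDensityOfStates.unique {N N' : Measure ℝ} (h : IsDensityOfStates v α lam N)
    (h' : IsDensityOfStates v α lam N') : N = N' := by
  have := h.1
  have := h'.1
  exact Measure.ext_of_integral_eq_on_compactlySupported fun f =>
    tendsto_nhds_unique (h.2 f f.continuous f.hasCompactSupport)
      (h'.2 f f.continuous f.hasCompactSupport)

end

/-! ### The eigenvalue-counting bound from monotonicity. -/

section

variable {v : ℝ → ℝ} {γm γp α lam : ℝ} {n : ℕ}

theorem specTrace_indicator (v : ℝ → ℝ) (α lam : ℝ) (n : ℕ) (E x : ℝ) :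
    specTrace v α lam n ((Set.Iic E).indicator 1) x = ((Finset.univ.filter fun i =>
      (periodicRestriction_isHermitian v α lam n x).eigenvalues i ≤ E).card : ℝ) := by
  simp only [specTrace_eq_sum, Set.indicator_apply, Set.mem_Iic, Pi.one_apply, Finset.sum_boole]

/-- Shifting the phase by `c` moves the eigenvalues up by `lam * γm * c`, except for one eigenvalue
for each site at which the potential jumps. -/
theorem IsMonotonePotential.specTrace_indicator_add_le (hv : IsMonotonePotential v γm γp)
    (hlam : 0 < lam) {c : ℝ} (hc : 0 ≤ c) (E x : ℝ) :
    specTrace v α lam n ((Set.Iic E).indicator 1) (x + c) ≤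
      specTrace v α lam n ((Set.Iic (E - lam * γm * c)).indicator 1) x +
        ∑ m : Fin n, (Set.Ici (1 - c)).indicator 1 (Int.fract (x + (m : ℕ) * α)) := by
  classical
  have h := Matrix.IsHermitian.card_eigenvalues_le
    (periodicRestriction_isHermitian v α lam n (x + c))
    (periodicRestriction_isHermitian v α lam n x)
    (Finset.univ.filter fun m : Fin n => 1 - c ≤ Int.fract (x + (m : ℕ) * α)) (lam * γm * c) E
    fun ψ hψ => by
      rw [← sub_nonneg, ← sub_sub, dotProduct_periodicRestriction_sub, dotProduct, Finset.mul_sum,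
        ← Finset.sum_sub_distrib]
      refine Finset.sum_nonneg fun m _ => ?_
      -- At crossing sites `ψ` vanishes; elsewhere the potential rises by at least `lam * γm * c`.
      by_cases hm : 1 - c ≤ Int.fract (x + (m : ℕ) * α)
      · simp [hψ m (by simpa using hm)]
      · have := hv.fract_add_lt_one_increment hc
          (show Int.fract (x + (m : ℕ) * α) + c < 1 by linarith)
        rw [add_right_comm x c, mul_assoc lam γm c, mul_assoc, mul_assoc, ← pow_two,
          ← mul_sub, ← sub_mul]
        exact mul_nonneg hlam.le (mul_nonneg (sub_nonneg.2 this) (sq_nonneg _))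
  rw [specTrace_indicator, specTrace_indicator]
  simp only [Set.indicator_apply, Set.mem_Ici, Pi.one_apply, Finset.sum_boole]
  exact_mod_cast h

theorem integrableOn_indicator_fract (c a : ℝ) :
    IntegrableOn (fun x : ℝ => (Set.Ici c).indicator (1 : ℝ → ℝ) (Int.fract (x + a)))
      (Set.Ico 0 1) := by
  refine Measure.integrableOn_of_bounded (M := 1) (by simp) ?_ (Eventually.of_forall fun x => ?_)
  · exact ((measurable_one.indicator measurableSet_Ici).comp
      (measurable_fract.comp (measurable_id.add_const a))).aestronglyMeasurable
  · rw [Set.indicator_apply]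
    split_ifs <;> simp

/-- By translation invariance on the circle this is the length of `[1 - c, 1) ∩ [0, 1)`, which is
below `c` when `c > 1`. -/
theorem setIntegral_indicator_fract_le {c : ℝ} (hc : 0 ≤ c) (a : ℝ) :
    ∫ x in Set.Ico (0 : ℝ) 1, (Set.Ici (1 - c)).indicator (1 : ℝ → ℝ) (Int.fract (x + a)) ≤ c := by
  have hp : Function.Periodic
      (fun x : ℝ => (Set.Ici (1 - c)).indicator (1 : ℝ → ℝ) (Int.fract x)) 1 := fun x => by
    simp only [Int.fract_add_one]
  rw [setIntegral_Ico_add_eq_of_periodic hp a, setIntegral_congr_fun measurableSet_Ico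
    (g := (Set.Ici (1 - c)).indicator (1 : ℝ → ℝ)) fun x hx => by
      simp only [Int.fract_eq_self.2 hx], integral_indicator_one measurableSet_Ici]
  have hsub : Set.Ici (1 - c) ∩ Set.Ico 0 1 ⊆ Set.Icc (1 - c) 1 := fun x hx => ⟨hx.1, hx.2.2.le⟩
  rw [measureReal_restrict_apply measurableSet_Ici]
  refine (measureReal_mono hsub (by simp)).trans ?_
  rw [Real.volume_real_Icc]
  simp [hc]

theorem IsMonotonePotential.integrableOn_specTrace_indicator (hv : IsMonotonePotential v γm γp)
    (hlam : 0 < lam) (E : ℝ) :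
    IntegrableOn (specTrace v α lam n ((Set.Iic E).indicator 1)) (Set.Ico 0 1) :=
  hv.integrableOn_specTrace hlam (hv.measurable_specTrace_Iic hlam E) (C := 1) fun t _ => by
    rw [Set.indicator_apply]
    split_ifs <;> simp

/-- The left side does not change when the phase is shifted by `c`, while each of the `n` sites is a
crossing for a set of phases of measure at most `c`. -/
theorem IsMonotonePotential.setIntegral_specTrace_indicator_le (hv : IsMonotonePotential v γm γp)
    (hlam : 0 < lam) {c : ℝ} (hc : 0 ≤ c) (E : ℝ) :
    ∫ x in Set.Ico (0 : ℝ) 1, specTrace v α lam n ((Set.Iic E).indicator 1) x ≤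
      (∫ x in Set.Ico (0 : ℝ) 1,
        specTrace v α lam n ((Set.Iic (E - lam * γm * c)).indicator 1) x) + n * c := by
  have hJ : IntegrableOn (fun x => ∑ m : Fin n,
      (Set.Ici (1 - c)).indicator (1 : ℝ → ℝ) (Int.fract (x + (m : ℕ) * α))) (Set.Ico 0 1) :=
    integrable_finsetSum _ fun m _ => integrableOn_indicator_fract _ _
  have hI := hv.integrableOn_specTrace_indicator (α := α) (n := n) hlam (E - lam * γm * c)
  calc ∫ x in Set.Ico (0 : ℝ) 1, specTrace v α lam n ((Set.Iic E).indicator 1) x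
      = ∫ x in Set.Ico (0 : ℝ) 1, specTrace v α lam n ((Set.Iic E).indicator 1) (x + c) :=
        (setIntegral_Ico_add_eq_of_periodic (hv.specTrace_periodic _) c).symm
    _ ≤ ∫ x in Set.Ico (0 : ℝ) 1,
        (specTrace v α lam n ((Set.Iic (E - lam * γm * c)).indicator 1) x +
          ∑ m : Fin n, (Set.Ici (1 - c)).indicator 1 (Int.fract (x + (m : ℕ) * α))) := by
        refine integral_mono_of_nonneg (Eventually.of_forall fun x => ?_) (hI.add hJ)
          (Eventually.of_forall fun x => hv.specTrace_indicator_add_le hlam hc E x)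
        simp only [specTrace_indicator]
        positivity
    _ ≤ _ := by
        rw [integral_add hI hJ, integral_finsetSum _ fun m _ => integrableOn_indicator_fract _ _]
        gcongr
        refine (Finset.sum_le_card_nsmul _ _ c
          fun m _ => setIntegral_indicator_fract_le hc _).trans ?_
        simp

theorem IsMonotonePotential.avgTrace_le_of_support (hv : IsMonotonePotential v γm γp)
    (hlam : 0 < lam) {f : ℝ → ℝ} (hf : Continuous f) (h1 : ∀ t, f t ≤ 1) {a b : ℝ} (hab : a ≤ b)
    (h0 : ∀ t, t ∉ Set.Ioc a b → f t = 0) (n : ℕ) :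
    avgTrace v α lam f n ≤ (b - a) / (lam * γm) := by
  have hγ : 0 < lam * γm := mul_pos hlam hv.gamma_minus_pos
  have hc : 0 ≤ (b - a) / (lam * γm) := div_nonneg (sub_nonneg.2 hab) hγ.le
  -- For `n = 0` the prefactor `1 / 0` is `0`.
  rcases eq_or_ne n 0 with rfl | hn
  · simpa [avgTrace] using hc
  have hle : ∀ x, specTrace v α lam n f x + specTrace v α lam n ((Set.Iic a).indicator 1) x ≤
      specTrace v α lam n ((Set.Iic b).indicator 1) x := fun x => by
    rw [← specTrace_add]
    refine hv.specTrace_le hlam (fun t _ => ?_) x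
    simp only [Pi.add_apply, Set.indicator_apply, Set.mem_Iic, Pi.one_apply]
    by_cases hta : t ≤ a
    · rw [h0 t fun h => absurd h.1 (not_lt.2 hta), if_pos hta, if_pos (hta.trans hab)]
      simp
    · by_cases htb : t ≤ b
      · simpa [hta, htb] using h1 t
      · simp [hta, htb, h0 t fun h => htb h.2]
  have hif := hv.integrableOn_specTrace_of_continuous (α := α) (n := n) hlam hf
  have hia := hv.integrableOn_specTrace_indicator (α := α) (n := n) hlam a
  have hib := hv.integrableOn_specTrace_indicator (α := α) (n := n) hlam b
  have hint := integral_mono (hif.add hia) hib hle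
  have hkey := hv.setIntegral_specTrace_indicator_le (α := α) (n := n) hlam hc b
  -- The shift `c = (b - a) / (lam * γm)` is the one that takes the energy `b` down to `a`.
  rw [mul_div_cancel₀ _ hγ.ne', sub_sub_cancel] at hkey
  simp only [Pi.add_apply] at hint
  rw [integral_add hif hia] at hint
  have hn' : (0 : ℝ) < n := by positivity
  rw [avgTrace, one_div, inv_mul_le_iff₀ hn']
  linarith

end

/-! ### Regularity of the limiting measure. -/

namespace IsDensityOfStates

variable {v : ℝ → ℝ} {γm γp α lam : ℝ} {N : Measure ℝ}

/-- A bump function which is `1` on `[a, b]` and `0` outside `(a - δ, b + δ)`. -/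
theorem _root_.exists_continuous_bump_Icc (a b : ℝ) {δ : ℝ} (hδ : 0 < δ) :
    ∃ f : ℝ → ℝ, Continuous f ∧ HasCompactSupport f ∧ (∀ t, 0 ≤ f t) ∧ (∀ t, f t ≤ 1) ∧
      (∀ t ∈ Set.Icc a b, f t = 1) ∧ ∀ t ∉ Set.Ioo (a - δ) (b + δ), f t = 0 := by
  obtain ⟨f, h1, h0, hc, hf⟩ := exists_continuous_one_zero_of_isCompact (isCompact_Icc (a := a)
    (b := b)) (isOpen_Ioo (a := a - δ) (b := b + δ)).isClosed_compl
    (Set.disjoint_compl_right_iff_subset.2 fun t ht => ⟨by linarith [ht.1], by linarith [ht.2]⟩)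
  exact ⟨f, f.continuous, hc, fun t => (hf t).1, fun t => (hf t).2, h1, h0⟩

/-- An eventual bound on the averaged trace of a bump function bounds the measure of the set on
which it equals `1`. -/
theorem measure_le_of_avgTrace_le (hN : IsDensityOfStates v α lam N) {f : ℝ → ℝ}
    (hf : Continuous f) (hfc : HasCompactSupport f) (h0 : ∀ t, 0 ≤ f t) {s : Set ℝ}
    (hs : MeasurableSet s) (h1 : ∀ t ∈ s, f t = 1) {u : ℕ → ℝ} {C : ℝ}
    (hu : Tendsto u atTop (𝓝 C)) (hle : ∀ᶠ n in atTop, avgTrace v α lam f n ≤ u n) :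
    N s ≤ ENNReal.ofReal C := by
  have := hN.1
  have hint : ∫ E, f E ∂N ≤ C := le_of_tendsto_of_tendsto (hN.2 f hf hfc) hu hle
  have hfi : Integrable f N := hf.integrable_of_hasCompactSupport hfc
  calc N s = ∫⁻ E, s.indicator 1 E ∂N := (lintegral_indicator_one hs).symm
    _ ≤ ∫⁻ E, ENNReal.ofReal (f E) ∂N := lintegral_mono fun E => by
        by_cases h : E ∈ s
        · simp [h, h1 E h]
        · simp [h]
    _ = ENNReal.ofReal (∫ E, f E ∂N) :=
        (ofReal_integral_eq_lintegral_ofReal hfi (Eventually.of_forall h0)).symm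
    _ ≤ _ := ENNReal.ofReal_le_ofReal hint

/-- The trace bound applies to bumps supported in `[a - δ, b + δ]`; then `δ` tends to `0`. -/
theorem measure_Icc_le (hN : IsDensityOfStates v α lam N) (hv : IsMonotonePotential v γm γp)
    (hlam : 0 < lam) {a b : ℝ} (hab : a ≤ b) :
    N (Set.Icc a b) ≤ ENNReal.ofReal ((b - a) / (lam * γm)) := by
  have hlim : Tendsto (fun δ : ℝ => ENNReal.ofReal ((b + δ - (a - δ)) / (lam * γm))) (𝓝[>] 0)
      (𝓝 (ENNReal.ofReal ((b - a) / (lam * γm)))) := by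
    have : Continuous fun δ : ℝ => ENNReal.ofReal ((b + δ - (a - δ)) / (lam * γm)) :=
      ENNReal.continuous_ofReal.comp (by fun_prop)
    simpa using (this.tendsto 0).mono_left nhdsWithin_le_nhds
  refine ge_of_tendsto hlim ?_
  filter_upwards [self_mem_nhdsWithin] with δ hδ
  obtain ⟨f, hf, hfc, h0, h1, hone, hzero⟩ := exists_continuous_bump_Icc a b hδ
  refine hN.measure_le_of_avgTrace_le hf hfc h0 measurableSet_Icc hone tendsto_const_nhds
    (Eventually.of_forall fun n => hv.avgTrace_le_of_support hlam hf h1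
      (by linarith [Set.mem_Ioi.1 hδ]) (fun t ht => hzero t fun h => ht ⟨h.1, h.2.le⟩) n)

/-- Bumps bounded by `1` give mass at most `1`. No mass escapes, because a bump equal to `1` on
`[-(2 + lam), 2 + lam]` has average exactly `1` for every `n ≠ 0`. -/
theorem isProbabilityMeasure (hN : IsDensityOfStates v α lam N)
    (hv : IsMonotonePotential v γm γp) (hlam : 0 < lam) : IsProbabilityMeasure N := by
  have := hN.1
  constructor
  apply le_antisymm
  · have hmono : Monotone fun k : ℕ => Set.Icc (-(k : ℝ)) k := fun i j hij =>
      Set.Icc_subset_Icc (by simpa using hij) (by simpa using hij)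
    have hU : ⋃ k : ℕ, Set.Icc (-(k : ℝ)) k = Set.univ := by
      refine Set.eq_univ_of_forall fun t => ?_
      obtain ⟨k, hk⟩ := exists_nat_ge |t|
      exact Set.mem_iUnion.2 ⟨k, abs_le.1 hk⟩
    rw [← hU, hmono.measure_iUnion]
    refine iSup_le fun k => ?_
    obtain ⟨f, hf, hfc, h0, h1, hone, -⟩ := exists_continuous_bump_Icc (-(k : ℝ)) k one_pos
    rw [← ENNReal.ofReal_one]
    refine hN.measure_le_of_avgTrace_le hf hfc h0 measurableSet_Icc hone tendsto_const_nhds ?_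
    filter_upwards [eventually_ne_atTop 0] with n hn
    rw [← avgTrace_const (n := n) v α lam 1 hn]
    exact hv.avgTrace_le hlam hf continuous_const (fun t _ => h1 t) n
  · obtain ⟨f, hf, hfc, h0, h1, hone, -⟩ :=
      exists_continuous_bump_Icc (-(2 + lam)) (2 + lam) one_pos
    have hint : 1 ≤ ∫ E, f E ∂N := by
      refine ge_of_tendsto (hN.2 f hf hfc) ?_
      filter_upwards [eventually_ne_atTop 0] with n hn
      have hle := hv.avgTrace_le (α := α) hlam continuous_const hf (fun t ht => (hone t ht).ge) n
      rwa [avgTrace_const v α lam 1 hn] at hle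
    have hfi : Integrable f N := hf.integrable_of_hasCompactSupport hfc
    calc (1 : ENNReal) ≤ ENNReal.ofReal (∫ E, f E ∂N) := by simpa using hint
      _ = ∫⁻ E, ENNReal.ofReal (f E) ∂N :=
        ofReal_integral_eq_lintegral_ofReal hfi (Eventually.of_forall h0)
      _ ≤ ∫⁻ _, 1 ∂N := lintegral_mono fun E => by simpa using h1 E
      _ = N Set.univ := lintegral_one

theorem noAtoms (hN : IsDensityOfStates v α lam N) (hv : IsMonotonePotential v γm γp)
    (hlam : 0 < lam) : NullSingletonClass N :=
  ⟨fun a => by simpa using hN.measure_Icc_le hv hlam (le_refl a)⟩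

theorem integratedDOS_sub (hN : IsDensityOfStates v α lam N) (hv : IsMonotonePotential v γm γp)
    (hlam : 0 < lam) {a b : ℝ} (hab : a ≤ b) :
    integratedDOS N b - integratedDOS N a = N.real (Set.Ioc a b) := by
  have := hN.isProbabilityMeasure hv hlam
  rw [integratedDOS, integratedDOS, ← measureReal_sdiff (Set.Iic_subset_Iic.2 hab) measurableSet_Iic]
  congr 1
  ext t
  simp [and_comm]

theorem abs_integratedDOS_sub_le (hN : IsDensityOfStates v α lam N)
    (hv : IsMonotonePotential v γm γp) (hlam : 0 < lam) (E E' : ℝ) :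
    |integratedDOS N E' - integratedDOS N E| ≤ |E' - E| / (lam * γm) := by
  wlog h : E ≤ E' generalizing E E'
  · rw [abs_sub_comm, abs_sub_comm E' E]
    exact this E' E (not_le.1 h).le
  have := hN.isProbabilityMeasure hv hlam
  rw [hN.integratedDOS_sub hv hlam h, abs_of_nonneg measureReal_nonneg,
    abs_of_nonneg (sub_nonneg.2 h)]
  have hpos : 0 ≤ (E' - E) / (lam * γm) :=
    div_nonneg (sub_nonneg.2 h) (mul_pos hlam hv.gamma_minus_pos).le
  exact ENNReal.toReal_le_of_le_ofReal hpos
    ((measure_mono Set.Ioc_subset_Icc_self).trans (hN.measure_Icc_le hv hlam h))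

theorem lipschitzWith_integratedDOS (hN : IsDensityOfStates v α lam N)
    (hv : IsMonotonePotential v γm γp) (hlam : 0 < lam) :
    LipschitzWith (Real.toNNReal (1 / (lam * γm))) (integratedDOS N) :=
  LipschitzWith.of_dist_le' fun x y => by
    rw [Real.dist_eq, Real.dist_eq, div_mul_eq_mul_div, one_mul]
    exact hN.abs_integratedDOS_sub_le hv hlam y x

theorem absolutelyContinuous (hN : IsDensityOfStates v α lam N)
    (hv : IsMonotonePotential v γm γp) (hlam : 0 < lam) : N ≪ volume := by
  have := hN.isProbabilityMeasure hv hlam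
  set C : ℝ := 1 / (lam * γm) with hC
  have hC0 : 0 ≤ C := one_div_nonneg.2 (mul_pos hlam hv.gamma_minus_pos).le
  have hcont : Continuous (integratedDOS N) := (hN.lipschitzWith_integratedDOS hv hlam).continuous
  -- The Lipschitz bound makes `C * x - N(x)` monotone. Its Stieltjes measure is the complement of
  -- `N` in `C` times Lebesgue measure, so `N ≤ C • volume`.
  let G : StieltjesFunction ℝ :=
    { toFun := fun x => C * x - integratedDOS N x
      mono' := fun x y hxy => by
        have h := (le_abs_self _).trans (hN.abs_integratedDOS_sub_le hv hlam x y)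
        rw [abs_of_nonneg (sub_nonneg.2 hxy), ← one_div_mul_eq_div, ← hC] at h
        simp only
        linarith
      right_continuous' := fun x => by
        exact Continuous.continuousWithinAt (by fun_prop) }
  have hsum : N + G.measure = ENNReal.ofReal C • volume := by
    refine Measure.ext_of_Ioc' _ _ (fun a b _ => by simp [G.measure_Ioc]) fun a b hab => ?_
    have hd := hN.integratedDOS_sub hv hlam hab.le
    have hG : G b - G a = C * (b - a) - N.real (Set.Ioc a b) := by
      rw [← hd]
      change C * b - integratedDOS N b - (C * a - integratedDOS N a) = _
      ring
    have hG0 : 0 ≤ G b - G a := sub_nonneg.2 (G.mono hab.le)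
    rw [Measure.add_apply, G.measure_Ioc, Measure.smul_apply, Real.volume_Ioc, smul_eq_mul,
      ← ENNReal.ofReal_mul hC0, ← ofReal_measureReal (by simp),
      ← ENNReal.ofReal_add measureReal_nonneg hG0, hG]
    congr 1
    ring
  have hle : N ≤ ENNReal.ofReal C • volume := hsum ▸ Measure.le_add_right le_rfl
  exact (Measure.absolutelyContinuous_of_le hle).trans Measure.smul_absolutelyContinuous

end IsDensityOfStates

/-! ### The density of states gives no mass to the resolvent set. -/

/-- A bounded operator is bounded below off its spectrum. -/
theorem ContinuousLinearMap.exists_pos_mul_norm_le_of_notMem_spectrum {X : Type*}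
    [NormedAddCommGroup X] [NormedSpace ℂ X] {T : X →L[ℂ] X} {z : ℂ} (hz : z ∉ spectrum ℂ T) :
    ∃ ε > 0, ∀ ψ, ε * ‖ψ‖ ≤ ‖T ψ - z • ψ‖ := by
  rw [spectrum.notMem_iff] at hz
  obtain ⟨u, hu⟩ := hz
  set S : X →L[ℂ] X := ↑u⁻¹
  refine ⟨1 / (‖S‖ + 1), by positivity, fun ψ => ?_⟩
  have h1 : S (z • ψ - T ψ) = ψ := by
    have h := DFunLike.congr_fun (show S * ↑u = 1 from u.inv_mul) ψ
    rw [hu] at h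
    exact h
  have h2 := S.le_opNorm (z • ψ - T ψ)
  rw [h1, norm_sub_rev] at h2
  rw [one_div, inv_mul_le_iff₀ (by positivity)]
  linarith [norm_nonneg (T ψ - z • ψ)]

/-- The finitely supported element of `ℓ²(ℤ)` with the values `g` on `s`. -/
noncomputable def finsuppEllTwo (s : Finset ℤ) (g : ℤ → ℝ) : EllTwo :=
  ∑ i ∈ s, lp.single 2 i (g i : ℂ)

theorem finsuppEllTwo_apply {s : Finset ℤ} {g : ℤ → ℝ} (hg : ∀ m ∉ s, g m = 0) (m : ℤ) :
    finsuppEllTwo s g m = g m := by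
  rw [finsuppEllTwo, lp.coeFn_sum, Finset.sum_apply]
  simp only [lp.coeFn_single, Pi.single_apply]
  rw [Finset.sum_ite_eq]
  split_ifs with h
  · rfl
  · rw [hg m h]; simp

theorem norm_finsuppEllTwo_sq (s : Finset ℤ) (g : ℤ → ℝ) :
    ‖finsuppEllTwo s g‖ ^ 2 = ∑ i ∈ s, g i ^ 2 := by
  have h := lp.norm_sum_single (p := 2) (by norm_num) (fun i : ℤ => (g i : ℂ)) s
  rw [finsuppEllTwo]
  simpa using h

section

variable {v : ℝ → ℝ} {γm γp α lam : ℝ} {n : ℕ}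

theorem hamiltonian_finsuppEllTwo (hv : IsMonotonePotential v γm γp) (α lam x E : ℝ)
    {s : Finset ℤ} {g : ℤ → ℝ} (hg : ∀ m ∉ s, g m = 0)
    (hg' : ∀ m ∉ s, latticeStep (phasePotential v α lam x) g m = 0) :
    hamiltonian hv α lam x (finsuppEllTwo s g) - (E : ℂ) • finsuppEllTwo s g =
      finsuppEllTwo s fun m => latticeStep (phasePotential v α lam x) g m - E * g m := by
  ext m
  rw [finsuppEllTwo_apply fun m hm => by rw [hg m hm, hg' m hm]; simp, lp.coeFn_sub, Pi.sub_apply,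
    hamiltonian_apply, lp.coeFn_smul, Pi.smul_apply, finsuppEllTwo_apply hg,
    finsuppEllTwo_apply hg, finsuppEllTwo_apply hg, latticeStep, phasePotential]
  simp

theorem latticeStep_translate (v : ℝ → ℝ) (α lam x : ℝ) (k : ℤ) (ψ : ℤ → ℝ) (m : ℤ) :
    latticeStep (phasePotential v α lam x) (fun m => ψ (m - k)) m =
      latticeStep (phasePotential v α lam (x + k * α)) ψ (m - k) := by
  simp only [latticeStep, phasePotential]
  rw [show m + 1 - k = m - k + 1 by ring, show m - 1 - k = m - k - 1 by ring]
  push_cast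
  rw [show x + k * α + (m - k) * α = x + m * α by ring]

/-- A lower bound for `H(x) - E` restricts to finitely supported vectors at the phases of the
orbit of `x`. -/
theorem IsMonotonePotential.sum_sq_le_of_bounded_below (hv : IsMonotonePotential v γm γp)
    {x E ε : ℝ} (hε : 0 < ε)
    (h : ∀ ψ, ε * ‖ψ‖ ≤ ‖hamiltonian hv α lam x ψ - (E : ℂ) • ψ‖) (k : ℤ) {ψ : ℤ → ℝ}
    (hψ : ∀ m : ℤ, m < 1 ∨ (n : ℤ) - 1 ≤ m → ψ m = 0) :
    ε ^ 2 * ∑ j : Fin n, ψ (j : ℕ) ^ 2 ≤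
      ∑ j : Fin n, (latticeStep (phasePotential v α lam (x + k * α)) ψ (j : ℕ) -
        E * ψ (j : ℕ)) ^ 2 := by
  -- The window `{k, …, k + n - 1}`: translating a test vector by `k` replaces the phase `x` by `x +
  -- k * α`.
  let e : Fin n ↪ ℤ := ⟨fun j => (j : ℕ) + k, fun i j hij => Fin.ext (by simpa using hij)⟩
  set s : Finset ℤ := Finset.univ.map e with hs
  have hmem : ∀ m, m ∉ s → m - k < 0 ∨ (n : ℤ) ≤ m - k := fun m hm => by
    by_contra! hcon
    refine hm (Finset.mem_map.2 ⟨⟨(m - k).toNat, by omega⟩, Finset.mem_univ _, ?_⟩)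
    change (((m - k).toNat : ℕ) : ℤ) + k = m
    omega
  have hg : ∀ m ∉ s, (fun m => ψ (m - k)) m = 0 := fun m hm => hψ _ (by
    have := hmem m hm; omega)
  have hg' : ∀ m ∉ s, latticeStep (phasePotential v α lam x) (fun m => ψ (m - k)) m = 0 :=
    fun m hm => by
      have := hmem m hm
      rw [latticeStep_translate, latticeStep, hψ _ (by omega), hψ _ (by omega), hψ _ (by omega)]
      ring
  have h2 := pow_le_pow_left₀ (by positivity) (h (finsuppEllTwo s fun m => ψ (m - k))) 2
  rw [hamiltonian_finsuppEllTwo hv α lam x E hg hg', mul_pow, norm_finsuppEllTwo_sq,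
    norm_finsuppEllTwo_sq, hs, Finset.sum_map, Finset.sum_map] at h2
  have he : ∀ j, e j - k = (j : ℕ) := fun j => add_sub_cancel_right _ _
  simpa only [latticeStep_translate, he] using h2

/-- By minimality of the rotation and right-continuity of the potential, the lower bound at one
phase extends to all phases. -/
theorem IsMonotonePotential.sum_sq_le_of_bounded_below_of_irrational
    (hv : IsMonotonePotential v γm γp) (hα : Irrational α)
    {x E ε : ℝ} (hε : 0 < ε)
    (h : ∀ ψ, ε * ‖ψ‖ ≤ ‖hamiltonian hv α lam x ψ - (E : ℂ) • ψ‖) (y : ℝ) {ψ : ℤ → ℝ}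
    (hψ : ∀ m : ℤ, m < 1 ∨ (n : ℤ) - 1 ≤ m → ψ m = 0) :
    ε ^ 2 * ∑ j : Fin n, ψ (j : ℕ) ^ 2 ≤
      ∑ j : Fin n, (latticeStep (phasePotential v α lam y) ψ (j : ℕ) - E * ψ (j : ℕ)) ^ 2 := by
  have hlim : Tendsto (fun t => ∑ j : Fin n,
      (latticeStep (phasePotential v α lam t) ψ (j : ℕ) - E * ψ (j : ℕ)) ^ 2) (𝓝[>] y)
      (𝓝 (∑ j : Fin n,
        (latticeStep (phasePotential v α lam y) ψ (j : ℕ) - E * ψ (j : ℕ)) ^ 2)) := by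
    refine tendsto_finsetSum _ fun j _ => ?_
    have hvj : Tendsto (fun t => v (t + ((j : ℕ) : ℤ) * α)) (𝓝[>] y)
        (𝓝 (v (y + ((j : ℕ) : ℤ) * α))) := by
      have h1 : ContinuousWithinAt (v ∘ fun t => t + ((j : ℕ) : ℤ) * α) (Set.Ici y) y :=
        (hv.continuousWithinAt_Ici _).comp (by fun_prop) fun t ht =>
          add_le_add_left (Set.mem_Ici.1 ht) _
      exact h1.tendsto.mono_left (nhdsWithin_mono _ Set.Ioi_subset_Ici_self)
    simp only [latticeStep, phasePotential]
    exact (((tendsto_const_nhds.add ((hvj.const_mul lam).mul_const _)).sub_const _).pow 2)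
  -- Since `v` is only right-continuous, `y` is approached from the right; it suffices that the
  -- orbit of `x` modulo `1` meets every interval `(y, z)`.
  refine ge_of_tendsto_of_frequently hlim ((nhdsGT_basis y).frequently_iff.2 fun z hz => ?_)
  have hd : Dense ((AddSubgroup.closure {α, 1} : AddSubgroup ℝ) : Set ℝ) :=
    dense_addSubgroupClosure_pair_iff.2 (by simpa using hα)
  obtain ⟨t, ht, htm⟩ := hd.exists_between (sub_lt_sub_right hz x)
  obtain ⟨k, l, hkl⟩ := AddSubgroup.mem_closure_pair.1 ht
  refine ⟨x + t, ⟨by linarith [htm.1], by linarith [htm.2]⟩, ?_⟩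
  have hphase : phasePotential v α lam (x + t) = phasePotential v α lam (x + k * α) := by
    funext m
    simp only [phasePotential]
    rw [← hkl, show x + (k • α + l • (1 : ℝ)) + m * α = x + k * α + m * α + l * 1 by
      simp only [zsmul_eq_mul]; ring, hv.periodic.int_mul l]
  rw [hphase]
  exact hv.sum_sq_le_of_bounded_below hε h k hψ

/-- The two exceptions are the end sites: on vectors vanishing there the restriction acts like the
operator on `ℤ`, and inherits its lower bound. -/
theorem IsMonotonePotential.card_eigenvalues_le_two (hv : IsMonotonePotential v γm γp)
    (hα : Irrational α) {x E ε : ℝ} (hε : 0 < ε)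
    (h : ∀ ψ, ε * ‖ψ‖ ≤ ‖hamiltonian hv α lam x ψ - (E : ℂ) • ψ‖) (y : ℝ) :
    (Finset.univ.filter fun i =>
      |(periodicRestriction_isHermitian v α lam n y).eigenvalues i - E| < ε).card ≤ 2 := by
  set P : Finset (Fin n) := Finset.univ.filter fun i => (i : ℕ) = 0 ∨ (i : ℕ) + 1 = n with hP
  have hcard : P.card ≤ 2 := by
    have : P.card ≤ ({0, n - 1} : Finset ℕ).card := by
      refine Finset.card_le_card_of_injOn (fun i => (i : ℕ)) (fun i hi => ?_)
        Fin.val_injective.injOn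
      have hi' : (i : ℕ) = 0 ∨ (i : ℕ) + 1 = n := by simpa [hP] using hi
      simp only [Finset.coe_insert, Finset.coe_singleton, Set.mem_insert_iff,
        Set.mem_singleton_iff]
      omega
    exact this.trans Finset.card_le_two
  refine (Matrix.IsHermitian.card_eigenvalues_abs_sub_lt_le _ P fun ψ hψ => ?_).trans hcard
  let φ : ℤ → ℝ := fun m => if hm : 0 ≤ m ∧ m < n then ψ ⟨m.toNat, by omega⟩ else 0
  have hφ : ∀ j : Fin n, φ (j : ℕ) = ψ j := fun j => by
    have := j.2
    simp [φ]
  have hφ0 : ∀ m : ℤ, m < 1 ∨ (n : ℤ) - 1 ≤ m → φ m = 0 := fun m hm => by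
    by_cases hm' : 0 ≤ m ∧ m < n
    · simp only [φ, dif_pos hm']
      refine hψ _ ?_
      simp only [hP, Finset.mem_filter, Finset.mem_univ, true_and]
      omega
    · simp only [φ, dif_neg hm']
  have hmul := periodicRestriction_mulVec_eq_latticeStep v α lam y hφ0
  simp only [hφ] at hmul
  have hkey := hv.sum_sq_le_of_bounded_below_of_irrational hα hε h y hφ0
  rw [hmul]
  simp only [hφ] at hkey
  simpa only [dotProduct, Pi.sub_apply, Pi.smul_apply, smul_eq_mul, ← pow_two] using hkey

/-- At most two eigenvalues near `E` give an average of at most `2 / n`, which tends to `0`. -/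
theorem IsDensityOfStates.exists_mem_nhds_measure_eq_zero {N : Measure ℝ}
    (hN : IsDensityOfStates v α lam N) (hv : IsMonotonePotential v γm γp) (hlam : 0 < lam)
    (hα : Irrational α) {x E : ℝ} (hE : (E : ℂ) ∉ spectrum ℂ (hamiltonian hv α lam x)) :
    ∃ u ∈ 𝓝 E, N u = 0 := by
  obtain ⟨ε, hε, h⟩ := ContinuousLinearMap.exists_pos_mul_norm_le_of_notMem_spectrum hE
  obtain ⟨f, hf, hfc, h0, h1, hone, hzero⟩ :=
    exists_continuous_bump_Icc (E - ε / 2) (E + ε / 2) (half_pos hε)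
  refine ⟨Set.Icc (E - ε / 2) (E + ε / 2), Icc_mem_nhds (by linarith) (by linarith), ?_⟩
  have htrace : ∀ n y, specTrace v α lam n f y ≤ 2 := fun n y => by
    rw [specTrace_eq_sum]
    calc _ ≤ ∑ i, if |(periodicRestriction_isHermitian v α lam n y).eigenvalues i - E| < ε
          then (1 : ℝ) else 0 := Finset.sum_le_sum fun i _ => by
            split_ifs with hi
            · exact h1 _
            · refine (hzero _ fun hmem => hi (abs_lt.2 ⟨?_, ?_⟩)).le
              · linarith [hmem.1]
              · linarith [hmem.2]
      _ ≤ 2 := by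
        rw [Finset.sum_boole]
        exact_mod_cast hv.card_eigenvalues_le_two hα hε h y
  have hle := hN.measure_le_of_avgTrace_le hf hfc h0 measurableSet_Icc hone
    (tendsto_const_div_atTop_nhds_zero_nat 2) (Eventually.of_forall fun n => by
      have hint := setIntegral_mono_on
        (hv.integrableOn_specTrace_of_continuous (α := α) (n := n) hlam hf)
        (integrableOn_const (C := (2 : ℝ)) (by simp)) measurableSet_Ico fun y _ => htrace n y
      rw [setIntegral_const] at hint
      simp only [Real.volume_real_Ico, sub_zero, zero_le_one, sup_of_le_left, smul_eq_mul,
        one_mul] at hint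
      rw [avgTrace, one_div, div_eq_inv_mul 2]
      exact mul_le_mul_of_nonneg_left hint (by positivity))
  simpa using hle

theorem IsDensityOfStates.volume_spectrum_pos {N : Measure ℝ}
    (hN : IsDensityOfStates v α lam N) (hv : IsMonotonePotential v γm γp) (hlam : 0 < lam)
    (hα : Irrational α) (x : ℝ) :
    0 < volume {E : ℝ | (E : ℂ) ∈ spectrum ℂ (hamiltonian hv α lam x)} := by
  have := hN.isProbabilityMeasure hv hlam
  rw [pos_iff_ne_zero]
  intro h0
  have h1 : N {E : ℝ | (E : ℂ) ∈ spectrum ℂ (hamiltonian hv α lam x)} = 0 :=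
    hN.absolutelyContinuous hv hlam h0
  have h2 : N {E : ℝ | (E : ℂ) ∈ spectrum ℂ (hamiltonian hv α lam x)}ᶜ = 0 :=
    measure_null_of_locally_null _ fun E hE => by
      obtain ⟨u, hu, hu0⟩ := hN.exists_mem_nhds_measure_eq_zero hv hlam hα hE
      exact ⟨u, mem_nhdsWithin_of_mem_nhds hu, hu0⟩
  have h3 := measure_union_le (μ := N)
    {E : ℝ | (E : ℂ) ∈ spectrum ℂ (hamiltonian hv α lam x)}
    {E : ℝ | (E : ℂ) ∈ spectrum ℂ (hamiltonian hv α lam x)}ᶜ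
  rw [Set.union_compl_self, measure_univ, h1, h2] at h3
  simp at h3

end

/-! ### The main theorem. -/

theorem theorem3p1 (v : ℝ → ℝ) (γm γp : ℝ) (hv : IsMonotonePotential v γm γp)
    (lam : ℝ) (hlam : 0 < lam) (α : ℝ) (hα : Irrational α) :
    -- the density of states measure exists and is unique
    (∃! N : Measure ℝ, IsDensityOfStates v α lam N) ∧
    (∀ N : Measure ℝ, IsDensityOfStates v α lam N →
      IsProbabilityMeasure N ∧
      (∀ E : ℝ, N (Set.Iio E) = N (Set.Iic E)) ∧
      (∃ K : NNReal, LipschitzWith K (integratedDOS N)) ∧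
      (∀ E E' : ℝ, |integratedDOS N E' - integratedDOS N E| ≤
        |E' - E| / (lam * (1 - erExponent α) * γm)) ∧
      N ≪ volume) ∧
    (∀ x : ℝ, 0 < volume {E : ℝ | (E : ℂ) ∈ spectrum ℂ (hamiltonian hv α lam x)}) := by
  obtain ⟨N₀, hN₀⟩ := hv.exists_isDensityOfStates α hlam
  refine ⟨⟨N₀, hN₀, fun N hN => hN.unique hN₀⟩, fun N hN => ⟨hN.isProbabilityMeasure hv hlam,
    fun E => ?_, ⟨_, hN.lipschitzWith_integratedDOS hv hlam⟩, fun E E' => ?_,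
    hN.absolutelyContinuous hv hlam⟩, fun x => hN₀.volume_spectrum_pos hv hlam hα x⟩
  · have := hN.noAtoms hv hlam
    exact measure_congr Iio_ae_eq_Iic
  -- As `0 < 1 - er(α) ≤ 1`, inserting this factor in the denominator only weakens the bound already
  -- proved.
  · obtain ⟨h0, h1⟩ := erExponent_mem_Icc hα
    have hγ := hv.gamma_minus_pos
    refine (hN.abs_integratedDOS_sub_le hv hlam E E').trans ?_
    have hpos : 0 < lam * (1 - erExponent α) * γm :=
      mul_pos (mul_pos hlam (by linarith)) hγ
    refine div_le_div_of_nonneg_left (abs_nonneg _) hpos ?_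
    exact mul_le_mul_of_nonneg_right (mul_le_of_le_one_right hlam.le (by linarith)) hγ.le
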